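/- Let $\mathcal M$ be the space of finite non-negative Borel measures on $\mathbb R_+=[0,\infty)$ with the weak topology (metrized by the Lévy metric). Let $D_S$ denote the space of paths $[0,\infty)\to S$ that are right continuous and have left limits, with the Skorokhod $J_1$ topology, and $C_S$ the space of continuous paths, with uniform convergence on compact sets. Let $D_{\mathcal M}^\uparrow$ (resp. $C_{\mathcal M}^\uparrow$) be the set of $\zeta$ in $D_{\mathcal M}$ (resp. $C_{\mathcal M}$) such that $t\mapsto\int f\,d\zeta_t$ is non-decreasing for every bounded continuous $f\ge 0$; let $D_{\mathcal M_0}^\uparrow$, $C_{\mathcal M_0}^\uparrow$ be the sets of those $\zeta$ in $D_{\mathcal M}^\uparrow$, $C_{\mathcal M}^\uparrow$ for which no $\zeta_t$ has an atom; and let $D_{\mathbb R}^\uparrow$, $C_{\mathbb R}^\uparrow$ be the sets of non-negative non-decreasing paths in $D_{\mathbb R}$, $C_{\mathbb R}$. Subsets carry the subspace topology. For $g\in D_{\mathbb R}^\uparrow$, "$dg$-a.e." refers to the Lebesgue–Stieltjes measure of $g$ on $[0,\infty)$, including the mass $g(0)$ at $0$. For $(\alpha,\mu)\in D_{\mathcal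 M}^\uparrow\times D_{\mathbb R}^\uparrow$, the measure-valued Skorokhod problem is to find $(\xi,\beta,\iota)\in D_{\mathcal M}\times D_{\mathcal M}^\uparrow\times D_{\mathbb R}^\uparrow$ such that for every $x\ge 0$: 1. $\xi[0,x]=\alpha[0,x]-\mu+\beta(x,\infty)+\iota$; 2. $\xi[0,x]=0$ $\;d\beta(x,\infty)$-a.e.; 3. $\xi[0,x]=0$ $\;d\iota$-a.e.; 4. $\beta[0,\infty)+\iota=\mu$. This problem has a unique solution for all data $(\alpha,\mu)\in D_{\mathcal M}^\uparrow\times D_{\mathbb R}^\uparrow$. The measure-valued Skorokhod map $\Theta:D_{\mathcal M}^\uparrow\times D_{\mathbb R}^\uparrow\to D_{\mathcal M}\times D_{\mathcal M}^\uparrow\times D_{\mathbb R}^\uparrow$, which maps $(\alpha,\mu)$ to this solution, has the following properties. (1) If $(\alpha^k,\mu^k)\in D_{\mathcal M}^\uparrow\times D_{\mathbb R}^\uparrow$, $k\in\mathbb N$, converge to $(\alpha,\mu)\in D_{\mathcal M_0}^\uparrow\times D_{\mathbb R}^\uparrow$ in $D_{\mathcal M\times\mathbb R}$, then $\Theta(\alpha^k,\mu^k)\to\Theta(\alpha,\mu)$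 in $D_{\mathcal M\times\mathcal M\times\mathbb R}$. In particular, $\Theta$ is continuous on $C_{\mathcal M_0}^\uparrow\times C_{\mathbb R}^\uparrow$: as a map from $D_{\mathcal M}^\uparrow\times D_{\mathbb R}^\uparrow$ with the product topology to $D_{\mathcal M\times\mathcal M\times\mathbb R}$ it is continuous at every point of $C_{\mathcal M_0}^\uparrow\times C_{\mathbb R}^\uparrow$, and its restriction to $C_{\mathcal M_0}^\uparrow\times C_{\mathbb R}^\uparrow$, with the topology of uniform convergence on compact sets, is continuous. (2) $\Theta$ is Borel measurable from $D_{\mathcal M}^\uparrow\times D_{\mathbb R}^\uparrow$ to $D_{\mathcal M}\times D_{\mathcal M}^\uparrow\times D_{\mathbb R}^\uparrow$. -/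

import Mathlib

open MeasureTheory Set Filter Topology
open scoped NNReal ENNReal BoundedContinuousFunction

noncomputable section

namespace MVSP

/-! ### Finite measures on the half-line -/

/-- The space of finite Borel measures on `[0, ∞)`. Mathlib's topology on it is the topology of
weak convergence, that is, convergence of integrals of bounded continuous functions. -/
abbrev M : Type := FiniteMeasure ℝ≥0

/-- `LevyClose ν₁ ν₂ ε`: `ν₁[0, x - ε] - ε ≤ ν₂[0, x] ≤ ν₁[0, x + ε] + ε` for all `x`, where
`[0, x - ε]` is empty if `x < ε`. (The first inequality, at the point `x + ε`, is the first
conjunct below.) -/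
def LevyClose (ν₁ ν₂ : M) (ε : ℝ≥0) : Prop :=
  ∀ x : ℝ≥0, ν₁ (Iic x) ≤ ν₂ (Iic (x + ε)) + ε ∧ ν₂ (Iic x) ≤ ν₁ (Iic (x + ε)) + ε

/-- The Lévy distance of two finite measures on `[0, ∞)`. -/
def levyDist (ν₁ ν₂ : M) : ℝ≥0 := sInf {ε : ℝ≥0 | 0 < ε ∧ LevyClose ν₁ ν₂ ε}

lemma LevyClose.symm {ν₁ ν₂ : M} {ε : ℝ≥0} (h : LevyClose ν₁ ν₂ ε) : LevyClose ν₂ ν₁ ε :=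
  fun x => (h x).symm

lemma LevyClose.mono {ν₁ ν₂ : M} {ε δ : ℝ≥0} (h : LevyClose ν₁ ν₂ ε) (hd : ε ≤ δ) :
    LevyClose ν₁ ν₂ δ := by
  intro x
  have hs : Iic (x + ε) ⊆ Iic (x + δ) := Iic_subset_Iic.2 (by gcongr)
  exact ⟨(h x).1.trans (add_le_add (FiniteMeasure.apply_mono _ hs) hd),
    (h x).2.trans (add_le_add (FiniteMeasure.apply_mono _ hs) hd)⟩

lemma LevyClose.trans {ν₁ ν₂ ν₃ : M} {ε δ : ℝ≥0} (h : LevyClose ν₁ ν₂ ε)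
    (h' : LevyClose ν₂ ν₃ δ) : LevyClose ν₁ ν₃ (ε + δ) := by
  intro x
  constructor
  · calc ν₁ (Iic x) ≤ ν₂ (Iic (x + ε)) + ε := (h x).1
      _ ≤ (ν₃ (Iic (x + ε + δ)) + δ) + ε := by gcongr; exact (h' _).1
      _ = _ := by rw [add_assoc x ε δ]; ring
  · calc ν₃ (Iic x) ≤ ν₂ (Iic (x + δ)) + δ := (h' x).2
      _ ≤ (ν₁ (Iic (x + δ + ε)) + ε) + δ := by gcongr; exact (h _).2
      _ = _ := by rw [add_assoc x δ ε, add_comm δ ε]; ring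

lemma levyDist_le {ν₁ ν₂ : M} {ε : ℝ≥0} (hε : 0 < ε) (h : LevyClose ν₁ ν₂ ε) :
    levyDist ν₁ ν₂ ≤ ε := csInf_le (OrderBot.bddBelow _) ⟨hε, h⟩

lemma levyClose_of_lt {ν₁ ν₂ : M} {ε : ℝ≥0} (h : levyDist ν₁ ν₂ < ε) : LevyClose ν₁ ν₂ ε := by
  have hne : {ε : ℝ≥0 | 0 < ε ∧ LevyClose ν₁ ν₂ ε}.Nonempty := by
    refine ⟨ν₁.mass + ν₂.mass + 1, by positivity, fun x => ⟨?_, ?_⟩⟩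
    · calc ν₁ (Iic x) ≤ ν₁.mass := ν₁.apply_le_mass _
        _ ≤ ν₁.mass + (ν₂.mass + 1 + ν₂ (Iic (x + (ν₁.mass + ν₂.mass + 1)))) :=
          le_add_of_nonneg_right zero_le
        _ = _ := by ring
    · calc ν₂ (Iic x) ≤ ν₂.mass := ν₂.apply_le_mass _
        _ ≤ ν₂.mass + (ν₁.mass + 1 + ν₁ (Iic (x + (ν₁.mass + ν₂.mass + 1)))) :=
          le_add_of_nonneg_right zero_le
        _ = _ := by ring
  obtain ⟨δ, ⟨_, hδ⟩, hlt⟩ := exists_lt_of_csInf_lt hne h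
  exact hδ.mono hlt.le

/-- The Lévy distance is a pseudometric. -/
@[reducible] def levyPseudoMetric : PseudoMetricSpace M where
  dist ν₁ ν₂ := levyDist ν₁ ν₂
  dist_self ν := by
    have : levyDist ν ν = 0 := by
      refine le_antisymm (le_of_forall_pos_le_add fun ε hε => ?_) zero_le
      rw [zero_add]
      refine levyDist_le hε fun x => ?_
      have : ν (Iic x) ≤ ν (Iic (x + ε)) + ε :=
        (ν.apply_mono (Iic_subset_Iic.2 le_self_add)).trans le_self_add
      exact ⟨this, this⟩
    simp [this]
  dist_comm ν₁ ν₂ := by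
    have : levyDist ν₁ ν₂ = levyDist ν₂ ν₁ := by
      unfold levyDist
      congr 1
      ext ε
      exact ⟨fun h => ⟨h.1, h.2.symm⟩, fun h => ⟨h.1, h.2.symm⟩⟩
    simp [this]
  dist_triangle ν₁ ν₂ ν₃ := by
    have : levyDist ν₁ ν₃ ≤ levyDist ν₁ ν₂ + levyDist ν₂ ν₃ := by
      refine le_of_forall_pos_le_add fun ε hε => ?_
      have h1 : levyDist ν₁ ν₂ < levyDist ν₁ ν₂ + ε / 2 := lt_add_of_pos_right _ (half_pos hε)
      have h2 : levyDist ν₂ ν₃ < levyDist ν₂ ν₃ + ε / 2 := lt_add_of_pos_right _ (half_pos hε)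
      calc levyDist ν₁ ν₃ ≤ (levyDist ν₁ ν₂ + ε / 2) + (levyDist ν₂ ν₃ + ε / 2) :=
            levyDist_le (by positivity) ((levyClose_of_lt h1).trans (levyClose_of_lt h2))
        _ = levyDist ν₁ ν₂ + levyDist ν₂ ν₃ + (ε / 2 + ε / 2) := by ring
        _ = _ := by rw [add_halves]
    exact_mod_cast this

lemma eventually_closed {ι : Type*} {L : Filter ι} {μs : ι → M} {μ : M}
    (h : Tendsto μs L (𝓝 μ)) {F : Set ℝ≥0} (hF : IsClosed F) {ε : ℝ≥0} (hε : 0 < ε) :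
    ∀ᶠ i in L, μs i F ≤ μ F + ε := by
  have h1 := FiniteMeasure.limsup_measure_closed_le_of_tendsto h hF
  have h2 : (μ : Measure ℝ≥0) F < (μ : Measure ℝ≥0) F + ε :=
    ENNReal.lt_add_right (measure_lt_top _ _).ne (by exact_mod_cast hε.ne')
  filter_upwards [eventually_lt_of_limsup_lt (h1.trans_lt h2)] with i hi
  rw [← FiniteMeasure.ennreal_coeFn_eq_coeFn_toMeasure,
    ← FiniteMeasure.ennreal_coeFn_eq_coeFn_toMeasure] at hi
  exact_mod_cast hi.le

lemma apply_add_compl (μ : M) {s : Set ℝ≥0} (hs : MeasurableSet s) : μ s + μ sᶜ = μ.mass := by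
  have := measure_add_measure_compl (μ := (μ : Measure ℝ≥0)) hs
  rw [← FiniteMeasure.ennreal_coeFn_eq_coeFn_toMeasure,
    ← FiniteMeasure.ennreal_coeFn_eq_coeFn_toMeasure, ← FiniteMeasure.ennreal_mass] at this
  exact_mod_cast this

lemma eventually_open {ι : Type*} {L : Filter ι} {μs : ι → M} {μ : M}
    (h : Tendsto μs L (𝓝 μ)) {G : Set ℝ≥0} (hG : IsOpen G) {ε : ℝ≥0} (hε : 0 < ε) :
    ∀ᶠ i in L, μ G ≤ μs i G + ε := by
  have hm : ∀ᶠ i in L, μ.mass < (μs i).mass + ε / 2 := by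
    have : Tendsto (fun i => (μs i).mass + ε / 2) L (𝓝 (μ.mass + ε / 2)) :=
      h.mass.add tendsto_const_nhds
    exact this.eventually_const_lt (lt_add_of_pos_right _ (half_pos hε))
  filter_upwards [hm, eventually_closed h hG.isClosed_compl (half_pos hε)] with i h1 h2
  have e1 := apply_add_compl μ hG.measurableSet
  have e2 := apply_add_compl (μs i) hG.measurableSet
  rw [← NNReal.coe_le_coe] at h2 ⊢
  rw [← NNReal.coe_lt_coe] at h1
  rw [← NNReal.coe_inj] at e1 e2
  push_cast at *
  linarith

/-- Weak convergence implies convergence in the Lévy distance. -/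
lemma eventually_levyClose {ι : Type*} {L : Filter ι} {μs : ι → M} {μ : M}
    (h : Tendsto μs L (𝓝 μ)) {ε : ℝ≥0} (hε : 0 < ε) : ∀ᶠ i in L, LevyClose (μs i) μ ε := by
  have hlim : Tendsto (fun n : ℕ => (μ : Measure ℝ≥0) (Ici ((n : ℝ≥0) * ε))) atTop (𝓝 0) := by
    have hempty : (⋂ n : ℕ, Ici ((n : ℝ≥0) * ε)) = ∅ := by
      ext x
      simp only [mem_iInter, mem_Ici, mem_empty_iff_false, iff_false, not_forall, not_le]
      obtain ⟨n, hn⟩ := exists_nat_gt (x / ε)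
      exact ⟨n, (div_lt_iff₀ hε).1 hn⟩
    have := tendsto_measure_iInter_atTop (μ := (μ : Measure ℝ≥0))
      (s := fun n : ℕ => Ici ((n : ℝ≥0) * ε)) (fun n => measurableSet_Ici.nullMeasurableSet)
      (fun m n hmn => Ici_subset_Ici.2 (by gcongr)) ⟨0, measure_ne_top _ _⟩
    rwa [hempty, measure_empty] at this
  obtain ⟨m, hm⟩ : ∃ m : ℕ, (μ : Measure ℝ≥0) (Ici ((m : ℝ≥0) * ε)) < (ε / 2 : ℝ≥0) :=
    (hlim.eventually_lt_const (by exact_mod_cast half_pos hε)).exists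
  rw [← FiniteMeasure.ennreal_coeFn_eq_coeFn_toMeasure] at hm
  have hm' : μ (Ici ((m : ℝ≥0) * ε)) < ε / 2 := by exact_mod_cast hm
  have hc : ∀ᶠ i in L, ∀ j ∈ Finset.range (m + 1),
      μs i (Iic ((j : ℝ≥0) * ε)) ≤ μ (Iic ((j : ℝ≥0) * ε)) + ε :=
    (Finset.eventually_all _).2 fun j _ => eventually_closed h isClosed_Iic hε
  have ho : ∀ᶠ i in L, ∀ j ∈ Finset.range (m + 1),
      μ (Iio ((j : ℝ≥0) * ε)) ≤ μs i (Iio ((j : ℝ≥0) * ε)) + ε / 2 :=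
    (Finset.eventually_all _).2 fun j _ => eventually_open h isOpen_Iio (half_pos hε)
  filter_upwards [hc, ho, eventually_closed h isClosed_univ (half_pos hε)] with i hc ho hu
  intro x
  have hsplit : μ.mass ≤ μ (Iio ((m : ℝ≥0) * ε)) + ε / 2 := by
    rw [← apply_add_compl μ measurableSet_Iio, compl_Iio]
    gcongr
  have hhalf : ∀ a : ℝ≥0, a + ε / 2 + ε / 2 = a + ε := fun a => by rw [add_assoc, add_halves]
  by_cases hx : (m : ℝ≥0) * ε ≤ x
  · have hsub : Iio ((m : ℝ≥0) * ε) ⊆ Iic (x + ε) := fun y hy =>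
      (le_of_lt hy).trans (hx.trans le_self_add)
    constructor
    · calc μs i (Iic x) ≤ (μs i) univ := (μs i).apply_mono (subset_univ _)
        _ ≤ μ.mass + ε / 2 := hu
        _ ≤ μ (Iio ((m : ℝ≥0) * ε)) + ε / 2 + ε / 2 := by gcongr
        _ = μ (Iio ((m : ℝ≥0) * ε)) + ε := hhalf _
        _ ≤ _ := by gcongr
    · calc μ (Iic x) ≤ μ.mass := μ.apply_le_mass _
        _ ≤ μ (Iio ((m : ℝ≥0) * ε)) + ε / 2 := hsplit
        _ ≤ μs i (Iio ((m : ℝ≥0) * ε)) + ε / 2 + ε / 2 := by gcongr; exact ho m (by simp)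
        _ = μs i (Iio ((m : ℝ≥0) * ε)) + ε := hhalf _
        _ ≤ _ := by gcongr
  · push Not at hx
    -- `x` lies in `[j ε, (j + 1) ε)` with `j + 1 ≤ m`
    set j : ℕ := ⌊x / ε⌋₊ with hj
    have hj1 : (j : ℝ≥0) * ε ≤ x := (le_div_iff₀ hε).1 (Nat.floor_le zero_le)
    have hj2 : x < ((j + 1 : ℕ) : ℝ≥0) * ε := by
      rw [← div_lt_iff₀ hε]
      exact_mod_cast Nat.lt_floor_add_one (x / ε)
    have hjm : j + 1 ∈ Finset.range (m + 1) := by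
      have : (j : ℝ≥0) * ε < m * ε := hj1.trans_lt hx
      have : (j : ℝ≥0) < m := lt_of_mul_lt_mul_right this zero_le
      have : j < m := by exact_mod_cast this
      simp only [Finset.mem_range]
      omega
    have hj3 : ((j + 1 : ℕ) : ℝ≥0) * ε ≤ x + ε := by
      push_cast
      rw [add_mul, one_mul]
      gcongr
    constructor
    · calc μs i (Iic x) ≤ μs i (Iic (((j + 1 : ℕ) : ℝ≥0) * ε)) :=
            (μs i).apply_mono (Iic_subset_Iic.2 hj2.le)
        _ ≤ μ (Iic (((j + 1 : ℕ) : ℝ≥0) * ε)) + ε := hc _ hjm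
        _ ≤ _ := by gcongr
    · calc μ (Iic x) ≤ μ (Iio (((j + 1 : ℕ) : ℝ≥0) * ε)) :=
            μ.apply_mono fun y hy => lt_of_le_of_lt hy hj2
        _ ≤ μs i (Iio (((j + 1 : ℕ) : ℝ≥0) * ε)) + ε / 2 := ho _ hjm
        _ ≤ μs i (Iio (((j + 1 : ℕ) : ℝ≥0) * ε)) + ε := by gcongr; exact half_le_self zero_le
        _ ≤ _ := by gcongr; exact fun y hy => (le_of_lt hy).trans hj3

/-- Convergence in the Lévy distance implies convergence of the distribution functions at the
points that are not atoms of the limit. -/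
lemma tendsto_Iic {ι : Type*} {L : Filter ι} {μs : ι → M} {μ : M}
    (h : ∀ ε : ℝ≥0, 0 < ε → ∀ᶠ i in L, LevyClose (μs i) μ ε) {x : ℝ≥0} (hx : μ {x} = 0) :
    Tendsto (fun i => μs i (Iic x)) L (𝓝 (μ (Iic x))) := by
  have hup : Tendsto (fun n : ℕ => μ (Iic (x + 1 / ((n : ℝ≥0) + 1)))) atTop (𝓝 (μ (Iic x))) := by
    have hi : (⋂ n : ℕ, Iic (x + 1 / ((n : ℝ≥0) + 1))) = Iic x := by
      ext y
      simp only [mem_iInter, mem_Iic]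
      refine ⟨fun hy => le_of_forall_pos_le_add fun ε hε => ?_, fun hy n => hy.trans le_self_add⟩
      obtain ⟨n, hn⟩ := NNReal.exists_nat_pos_inv_lt hε
      refine (hy n).trans ?_
      gcongr
      refine le_trans ?_ hn.2.le
      rw [one_div]
      exact inv_anti₀ (by exact_mod_cast hn.1) le_self_add
    have := tendsto_measure_iInter_atTop (μ := (μ : Measure ℝ≥0))
      (s := fun n : ℕ => Iic (x + 1 / ((n : ℝ≥0) + 1)))
      (fun n => measurableSet_Iic.nullMeasurableSet)
      (fun m n hmn => Iic_subset_Iic.2 (by gcongr)) ⟨0, measure_ne_top _ _⟩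
    rw [hi] at this
    exact (ENNReal.tendsto_toNNReal (measure_ne_top _ _)).comp this
  have hinv : Tendsto (fun n : ℕ => 1 / ((n : ℝ≥0) + 1)) atTop (𝓝 0) := by
    rw [← NNReal.tendsto_coe]
    simpa using tendsto_one_div_add_atTop_nhds_zero_nat (𝕜 := ℝ)
  have hlow : Tendsto (fun n : ℕ => μ {y | y + 1 / ((n : ℝ≥0) + 1) ≤ x}) atTop
      (𝓝 (μ (Iic x))) := by
    have hi : (⋃ n : ℕ, {y | y + 1 / ((n : ℝ≥0) + 1) ≤ x}) = Iio x := by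
      ext y
      simp only [mem_iUnion, mem_Iio, mem_ofPred_eq]
      refine ⟨fun ⟨n, hn⟩ => lt_of_lt_of_le (lt_add_of_pos_right _ (by positivity)) hn,
        fun hy => ?_⟩
      have : Tendsto (fun n : ℕ => y + 1 / ((n : ℝ≥0) + 1)) atTop (𝓝 (y + 0)) :=
        tendsto_const_nhds.add hinv
      rw [add_zero] at this
      exact (this.eventually_le_const hy).exists
    have hmono : Monotone fun n : ℕ => {y | y + 1 / ((n : ℝ≥0) + 1) ≤ x} := by
      intro m n hmn y hy
      refine le_trans ?_ (show y + 1 / ((m : ℝ≥0) + 1) ≤ x from hy)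
      gcongr
    have := tendsto_measure_iUnion_atTop (μ := (μ : Measure ℝ≥0)) hmono
    rw [hi] at this
    have he : (μ : Measure ℝ≥0) (Iio x) = (μ : Measure ℝ≥0) (Iic x) := by
      refine le_antisymm (measure_mono Iio_subset_Iic_self) ?_
      rw [← Iio_union_right]
      refine (measure_union_le _ _).trans ?_
      rw [(FiniteMeasure.null_iff_toMeasure_null μ {x}).1 hx, add_zero]
    rw [he] at this
    exact (ENNReal.tendsto_toNNReal (measure_ne_top _ _)).comp this
  have hup' : Tendsto (fun n : ℕ => μ (Iic (x + 1 / ((n : ℝ≥0) + 1))) + 1 / ((n : ℝ≥0) + 1))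
      atTop (𝓝 (μ (Iic x))) := by simpa using hup.add hinv
  refine tendsto_order.2 ⟨fun a ha => ?_, fun a ha => ?_⟩
  · have h2 : Tendsto (fun n : ℕ => a + 1 / ((n : ℝ≥0) + 1)) atTop (𝓝 a) := by
      simpa using tendsto_const_nhds.add hinv
    obtain ⟨n, hn⟩ := (h2.eventually_lt hlow ha).exists
    filter_upwards [h _ (show (0 : ℝ≥0) < 1 / ((n : ℝ≥0) + 1) by positivity)] with i hi
    by_cases hnx : 1 / ((n : ℝ≥0) + 1) ≤ x
    · have := (hi (x - 1 / ((n : ℝ≥0) + 1))).2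
      rw [tsub_add_cancel_of_le hnx] at this
      have hsub : {y | y + 1 / ((n : ℝ≥0) + 1) ≤ x} ⊆ Iic (x - 1 / ((n : ℝ≥0) + 1)) :=
        fun y hy => mem_Iic.2 (le_tsub_of_add_le_right (show y + 1 / ((n : ℝ≥0) + 1) ≤ x from hy))
      exact lt_of_add_lt_add_right (hn.trans_le ((μ.apply_mono hsub).trans this))
    · have hemp : {y | y + 1 / ((n : ℝ≥0) + 1) ≤ x} = ∅ := by
        ext y
        simp only [mem_ofPred_eq, mem_empty_iff_false, iff_false]
        exact fun hy => hnx (le_add_self.trans hy)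
      rw [hemp] at hn
      simp at hn
  · obtain ⟨n, hn⟩ := (hup'.eventually_lt_const ha).exists
    filter_upwards [h _ (show (0 : ℝ≥0) < 1 / ((n : ℝ≥0) + 1) by positivity)] with i hi
    exact (hi x).1.trans_lt hn

lemma LevyClose.mass_le {ν₁ ν₂ : M} {ε : ℝ≥0} (h : LevyClose ν₁ ν₂ ε) :
    ν₁.mass ≤ ν₂.mass + ε := by
  have hlim : Tendsto (fun n : ℕ => ν₁ (Iic (n : ℝ≥0))) atTop (𝓝 ν₁.mass) := by
    have hi : (⋃ n : ℕ, Iic (n : ℝ≥0)) = univ := by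
      ext y
      simpa using exists_nat_ge y
    have := tendsto_measure_iUnion_atTop (μ := (ν₁ : Measure ℝ≥0))
      (s := fun n : ℕ => Iic (n : ℝ≥0)) (fun m n hmn => Iic_subset_Iic.2 (by exact_mod_cast hmn))
    rw [hi] at this
    exact (ENNReal.tendsto_toNNReal (measure_ne_top _ _)).comp this
  refine le_of_tendsto' hlim fun n => (h _).1.trans ?_
  gcongr
  exact ν₂.apply_le_mass _

/-- Convergence in the Lévy distance implies weak convergence. -/
lemma tendsto_of_levyClose {ι : Type*} {L : Filter ι} [L.IsCountablyGenerated] {μs : ι → M}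
    {μ : M} (h : ∀ ε : ℝ≥0, 0 < ε → ∀ᶠ i in L, LevyClose (μs i) μ ε) : Tendsto μs L (𝓝 μ) := by
  have hmass : Tendsto (fun i => (μs i).mass) L (𝓝 μ.mass) := by
    refine Metric.tendsto_nhds.2 fun ε hε => ?_
    filter_upwards [h (⟨ε, hε.le⟩ / 2) (half_pos hε)] with i hi
    have h1 := NNReal.coe_le_coe.2 hi.mass_le
    have h2 := NNReal.coe_le_coe.2 hi.symm.mass_le
    push_cast at h1 h2
    rw [NNReal.dist_eq, abs_lt]
    change _ ≤ _ + ε / 2 at h1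
    change _ ≤ _ + ε / 2 at h2
    constructor <;> linarith
  rcases eq_or_ne μ 0 with rfl | hμ
  · exact FiniteMeasure.tendsto_zero_of_tendsto_zero_mass (by simpa using hmass)
  refine FiniteMeasure.tendsto_of_tendsto_normalize_testAgainstNN_of_tendsto_mass ?_ hmass
  have hμm : μ.mass ≠ 0 := μ.mass_nonzero_iff.2 hμ
  -- intervals whose end points are not atoms of the limit
  let S : Set (Set ℝ≥0) := {s | ∃ b, μ {b} = 0 ∧ (s = Iic b ∨ ∃ a, μ {a} = 0 ∧ s = Ioc a b)}
  have hS : IsPiSystem S := by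
    rintro _ ⟨b, hb, rfl | ⟨a, ha, rfl⟩⟩ _ ⟨d, hd, rfl | ⟨c, hc, rfl⟩⟩ -
    · refine ⟨min b d, ?_, Or.inl Iic_inter_Iic⟩
      rcases min_choice b d with h | h <;> rw [h] <;> assumption
    · refine ⟨min b d, ?_, Or.inr ⟨c, hc, ?_⟩⟩
      · rcases min_choice b d with h | h <;> rw [h] <;> assumption
      · ext y; simp only [mem_inter_iff, mem_Iic, mem_Ioc, le_min_iff]; tauto
    · refine ⟨min b d, ?_, Or.inr ⟨a, ha, ?_⟩⟩
      · rcases min_choice b d with h | h <;> rw [h] <;> assumption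
      · ext y; simp only [mem_inter_iff, mem_Iic, mem_Ioc, le_min_iff]; tauto
    · refine ⟨min b d, ?_, Or.inr ⟨max a c, ?_, Ioc_inter_Ioc⟩⟩
      · rcases min_choice b d with h | h <;> rw [h] <;> assumption
      · rcases max_choice a c with h | h <;> rw [h] <;> assumption
  have hcount : {y : ℝ≥0 | 0 < (μ : Measure ℝ≥0) {y}}.Countable :=
    Measure.countable_meas_pos_of_disjoint_iUnion (μ := (μ : Measure ℝ≥0))
      (As := fun y : ℝ≥0 => {y}) (fun y => measurableSet_singleton y)
      (fun y z hyz => by simpa [Function.onFun] using hyz)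
  have hatom : ∀ a b : ℝ≥0, a < b → ∃ c, a < c ∧ c < b ∧ μ {c} = 0 := by
    intro a b hab
    obtain ⟨r, hr, hr1, hr2⟩ := ((hcount.image ((↑) : ℝ≥0 → ℝ)).dense_compl ℝ).exists_between
      (NNReal.coe_lt_coe.2 hab)
    lift r to ℝ≥0 using a.coe_nonneg.trans hr1.le
    refine ⟨r, by exact_mod_cast hr1, by exact_mod_cast hr2, ?_⟩
    rw [FiniteMeasure.null_iff_toMeasure_null]
    by_contra hne
    exact hr ⟨r, pos_iff_ne_zero.2 hne, rfl⟩
  refine hS.tendsto_probabilityMeasure_of_tendsto_of_mem ?_ ?_ ?_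
  · rintro _ ⟨b, hb, rfl | ⟨a, ha, rfl⟩⟩
    · exact measurableSet_Iic
    · exact measurableSet_Ioc
  · intro u hu x hxu
    obtain ⟨ε, hε, hball⟩ := Metric.isOpen_iff.1 hu x hxu
    set e : ℝ≥0 := ⟨ε, hε.le⟩
    have he : 0 < e := hε
    obtain ⟨b, hb1, hb2, hb⟩ := hatom x (x + e) (lt_add_of_pos_right _ he)
    have hb2' : (b : ℝ) < x + ε := by exact_mod_cast hb2
    by_cases hx0 : x = 0
    · subst hx0
      refine ⟨Iic b, ⟨b, hb, Or.inl rfl⟩, Iic_mem_nhds hb1, fun y hy => hball ?_⟩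
      have hy' : (y : ℝ) ≤ b := by exact_mod_cast hy
      have := y.coe_nonneg
      rw [Metric.mem_ball, NNReal.dist_eq, abs_lt]
      simp only [NNReal.coe_zero] at *
      constructor <;> linarith
    · obtain ⟨a, ha1, ha2, ha⟩ := hatom (x - e) x
        (tsub_lt_self (pos_iff_ne_zero.2 hx0) he)
      have ha1' : (x : ℝ) - ε < a := by
        have h1 : x ≤ (x - e) + e := le_tsub_add
        have h2 : (x : ℝ) ≤ ((x - e : ℝ≥0) : ℝ) + ε := by exact_mod_cast h1
        have h3 : ((x - e : ℝ≥0) : ℝ) < a := by exact_mod_cast ha1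
        linarith
      refine ⟨Ioc a b, ⟨b, hb, Or.inr ⟨a, ha, rfl⟩⟩, Ioc_mem_nhds ha2 hb1, fun y hy => hball ?_⟩
      have hy1 : (a : ℝ) < y := by exact_mod_cast hy.1
      have hy2 : (y : ℝ) ≤ b := by exact_mod_cast hy.2
      rw [Metric.mem_ball, NNReal.dist_eq, abs_lt]
      constructor <;> linarith
  · have key : ∀ s, Tendsto (fun i => μs i s) L (𝓝 (μ s)) →
        Tendsto (fun i => (μs i).normalize s) L (𝓝 (μ.normalize s)) := by
      intro s hs
      have hne : ∀ᶠ i in L, μs i ≠ 0 := by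
        filter_upwards [hmass.eventually_ne hμm] with i hi
        exact (FiniteMeasure.mass_nonzero_iff _).1 hi
      rw [μ.normalize_eq_of_nonzero hμ]
      refine ((hmass.inv₀ hμm).mul hs).congr' ?_
      filter_upwards [hne] with i hi
      rw [(μs i).normalize_eq_of_nonzero hi]
    rintro _ ⟨b, hb, rfl | ⟨a, ha, rfl⟩⟩
    · exact key _ (tendsto_Iic h hb)
    · refine key _ ?_
      have hIoc : ∀ ν : M, ν (Ioc a b) = ν (Iic b) - ν (Iic (min a b)) := by
        intro ν
        have hd : Disjoint (Iic (min a b)) (Ioc a b) :=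
          Set.disjoint_left.2 fun y hy hy' => absurd (le_trans hy (min_le_left _ _)) (not_le.2 hy'.1)
        have hu : Iic b = Iic (min a b) ∪ Ioc a b := by
          ext y
          simp only [mem_union, mem_Iic, mem_Ioc, le_min_iff]
          rcases le_or_gt y a with h | h
          · simp [h, not_lt.2 h]
          · simp [h, not_le.2 h]
        have := measure_union (μ := (ν : Measure ℝ≥0)) hd measurableSet_Ioc
        rw [← hu, ← FiniteMeasure.ennreal_coeFn_eq_coeFn_toMeasure,
          ← FiniteMeasure.ennreal_coeFn_eq_coeFn_toMeasure,
          ← FiniteMeasure.ennreal_coeFn_eq_coeFn_toMeasure] at this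
        have h2 : ν (Iic b) = ν (Iic (min a b)) + ν (Ioc a b) := by exact_mod_cast this
        rw [h2, add_tsub_cancel_left]
      simp_rw [hIoc]
      refine (tendsto_Iic h hb).sub (tendsto_Iic h ?_)
      rcases min_choice a b with h | h <;> rw [h] <;> assumption

lemma levy_topology_eq :
    (inferInstance : TopologicalSpace M) = levyPseudoMetric.toUniformSpace.toTopologicalSpace := by
  refine TopologicalSpace.ext_nhds fun μ => le_antisymm ?_ ?_
  · rw [(@Metric.nhds_basis_ball M levyPseudoMetric μ).ge_iff]
    intro ε hε
    filter_upwards [eventually_levyClose (μs := id) (L := 𝓝 μ) (μ := μ) tendsto_id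
      (show (0 : ℝ≥0) < ⟨ε, hε.le⟩ / 2 from half_pos hε)] with ν hν
    have h1 := NNReal.coe_le_coe.2 (levyDist_le (half_pos (show (0 : ℝ≥0) < ⟨ε, hε.le⟩ from hε)) hν)
    change (levyDist ν μ : ℝ) ≤ ε / 2 at h1
    change (levyDist ν μ : ℝ) < ε
    have : ε / 2 < ε := half_lt_self hε
    linarith
  · have hcg : (@nhds M levyPseudoMetric.toUniformSpace.toTopologicalSpace μ).IsCountablyGenerated :=
      letI := levyPseudoMetric
      (Metric.nhds_basis_ball_inv_nat_succ (x := μ)).isCountablyGenerated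
    refine tendsto_of_levyClose (μs := id) fun ε hε => ?_
    have := @Metric.ball_mem_nhds M levyPseudoMetric μ ε hε
    filter_upwards [this] with ν hν
    exact levyClose_of_lt (show levyDist ν μ < ε by exact_mod_cast hν)

/-- The Lévy metric on the space of finite measures; its topology is the weak topology. -/
instance : PseudoMetricSpace M := levyPseudoMetric.replaceTopology levy_topology_eq

/-! ### Càdlàg paths and the Skorokhod `J₁` topology -/

/-- Right continuous on `[0, ∞)` with left limits on `(0, ∞)`. -/
def IsCadlag {S : Type*} [TopologicalSpace S] (x : ℝ≥0 → S) : Prop :=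
  (∀ t, ContinuousWithinAt x (Ici t) t) ∧ ∀ t, 0 < t → ∃ l, Tendsto x (𝓝[<] t) (𝓝 l)

/-- The space of càdlàg paths `[0, ∞) → S`. -/
structure D (S : Type*) [TopologicalSpace S] where
  /-- the path -/
  toFun : ℝ≥0 → S
  cadlag : IsCadlag toFun

instance {S : Type*} [TopologicalSpace S] : CoeFun (D S) fun _ => ℝ≥0 → S := ⟨D.toFun⟩

/-- The basic `J₁` entourages: `x` and `y` are within `ε` of each other on `[0, T]`, up to an
increasing bijective time change of `[0, ∞)` that moves no time in `[0, T]` by `ε` or more. -/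
def j1Entourage (S : Type*) [PseudoMetricSpace S] (T : ℝ≥0) (ε : ℝ) : Set (D S × D S) :=
  {p | ∃ τ : ℝ≥0 ≃o ℝ≥0, ∀ t ≤ T, dist (τ t) t < ε ∧ dist (p.2 (τ t)) (p.1 t) < ε}

lemma j1Entourage_mono {S : Type*} [PseudoMetricSpace S] {T T' : ℝ≥0} {ε ε' : ℝ} (hT : T ≤ T')
    (hε : ε' ≤ ε) : j1Entourage S T' ε' ⊆ j1Entourage S T ε := by
  rintro p ⟨τ, h⟩
  exact ⟨τ, fun t ht => ⟨(h t (ht.trans hT)).1.trans_le hε, (h t (ht.trans hT)).2.trans_le hε⟩⟩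

/-- The Skorokhod `J₁` uniformity and topology on the space of càdlàg paths: `x k → x` if and only
if for all `T` and `ε > 0`, eventually, some increasing bijection `τ` of `[0, ∞)` has
`|τ t - t| < ε` and `dist (x k (τ t)) (x t) < ε` for all `t ≤ T`. -/
instance {S : Type*} [PseudoMetricSpace S] : UniformSpace (D S) :=
  .ofCore <| .mkOfBasis
    { sets := {V | ∃ (T : ℝ≥0) (ε : ℝ), 0 < ε ∧ V = j1Entourage S T ε}
      nonempty := ⟨_, 0, 1, one_pos, rfl⟩
      inter_sets := by
        rintro _ _ ⟨T, ε, hε, rfl⟩ ⟨T', ε', hε', rfl⟩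
        exact ⟨_, ⟨max T T', min ε ε', lt_min hε hε', rfl⟩, subset_inter
          (j1Entourage_mono (le_max_left _ _) (min_le_left _ _))
          (j1Entourage_mono (le_max_right _ _) (min_le_right _ _))⟩ }
    (by
      rintro _ ⟨T, ε, hε, rfl⟩ x
      exact ⟨OrderIso.refl _, fun t _ => by simpa using hε⟩)
    (by
      rintro _ ⟨T, ε, hε, rfl⟩
      refine ⟨_, ⟨T + ⟨ε, hε.le⟩, ε, hε, rfl⟩, ?_⟩
      rintro ⟨x, y⟩ ⟨τ, h⟩
      refine ⟨τ.symm, fun t ht => ?_⟩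
      have hs : τ.symm t ≤ T + ⟨ε, hε.le⟩ := by
        by_contra! hlt
        have h1 := (h _ le_rfl).1
        have h2 : τ (T + ⟨ε, hε.le⟩) < t := by simpa using τ.strictMono hlt
        have h3 : (τ (T + ⟨ε, hε.le⟩) : ℝ) < T := by exact_mod_cast h2.trans_le ht
        rw [NNReal.dist_eq, abs_lt] at h1
        have h4 : ((T + ⟨ε, hε.le⟩ : ℝ≥0) : ℝ) = T + ε := rfl
        linarith [h1.1]
      have := h _ hs
      rw [OrderIso.apply_symm_apply] at this
      exact ⟨by rw [dist_comm]; exact this.1, by rw [dist_comm]; exact this.2⟩)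
    (by
      rintro _ ⟨T, ε, hε, rfl⟩
      refine ⟨_, ⟨T + ⟨ε, hε.le⟩, ε / 2, half_pos hε, rfl⟩, ?_⟩
      rintro ⟨x, z⟩ ⟨y, ⟨τ, h⟩, ⟨σ, h'⟩⟩
      refine ⟨τ.trans σ, fun t ht => ?_⟩
      have h1 := h t (ht.trans le_self_add)
      have h2 : τ t ≤ T + ⟨ε, hε.le⟩ := by
        have h3 := (abs_lt.1 (NNReal.dist_eq _ _ ▸ h1.1)).2
        have h4 : (t : ℝ) ≤ T := by exact_mod_cast ht
        rw [← NNReal.coe_le_coe]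
        change (τ t : ℝ) ≤ T + ε
        linarith
      have h3 := h' _ h2
      simp only [OrderIso.trans_apply]
      constructor
      · linarith [dist_triangle (σ (τ t)) (τ t) t, h1.1, h3.1]
      · linarith [dist_triangle (z (σ (τ t))) (y (τ t)) (x t), h1.2, h3.2])

/-- The path `t ↦ (x t, y t)`. -/
def D.pair {S S' : Type*} [TopologicalSpace S] [TopologicalSpace S'] (x : D S) (y : D S') :
    D (S × S') where
  toFun t := (x t, y t)
  cadlag := ⟨fun t => (x.cadlag.1 t).prodMk (y.cadlag.1 t), fun t ht => by
    obtain ⟨l, hl⟩ := x.cadlag.2 t ht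
    obtain ⟨l', hl'⟩ := y.cadlag.2 t ht
    exact ⟨(l, l'), hl.prodMk_nhds hl'⟩⟩

/-- A continuous path, as a càdlàg path. -/
def ofContinuous {S : Type*} [TopologicalSpace S] (x : C(ℝ≥0, S)) : D S where
  toFun := x
  cadlag := ⟨fun t => x.continuous.continuousWithinAt,
    fun t _ => ⟨x t, x.continuous.continuousAt.mono_left nhdsWithin_le_nhds⟩⟩

/-! ### The path spaces of the measure-valued Skorokhod problem -/

/-- `t ↦ ⟨f, ζ t⟩` is non-decreasing for every non-negative bounded continuous `f`. -/
def MonotonePath (ζ : ℝ≥0 → M) : Prop :=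
  ∀ f : ℝ≥0 →ᵇ ℝ, (∀ x, 0 ≤ f x) → Monotone fun t => ∫ x, f x ∂(ζ t : Measure ℝ≥0)

/-- `ζ t` has no atoms, for every `t`. -/
def AtomlessPath (ζ : ℝ≥0 → M) : Prop := ∀ t x, ζ t {x} = 0

/-- Non-decreasing càdlàg paths of finite measures, with the subspace topology of `J₁`. -/
abbrev DMup : Type := {ζ : D M // MonotonePath ζ}

/-- Non-negative non-decreasing real càdlàg paths, with the subspace topology of `J₁`. -/
abbrev DRup : Type := {g : D ℝ // (∀ t, 0 ≤ g t) ∧ Monotone g}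

/-- Non-decreasing continuous paths of finite measures without atoms, with the topology of uniform
convergence on compact sets. -/
abbrev CM0up : Type := {ζ : C(ℝ≥0, M) // MonotonePath ζ ∧ AtomlessPath ζ}

/-- Non-negative non-decreasing continuous real paths, with the topology of uniform convergence on
compact sets. -/
abbrev CRup : Type := {g : C(ℝ≥0, ℝ) // (∀ t, 0 ≤ g t) ∧ Monotone g}

/-- The inclusion of continuous data in càdlàg data. -/
def inclusion (q : CM0up × CRup) : DMup × DRup :=
  (⟨ofContinuous q.1, q.1.2.1⟩, ⟨ofContinuous q.2, q.2.2⟩)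

/-- The Lebesgue-Stieltjes measure on `[0, ∞)` of a path `g`, including the mass `g 0` at `0`.
(Mathlib's `StieltjesFunction.measure` on `[0, ∞)` is the part on `(0, ∞)`.) -/
def stieltjes (g : DRup) : Measure ℝ≥0 :=
  ENNReal.ofReal (g.1 0) • Measure.dirac 0 +
    (StieltjesFunction.mk (R := ℝ≥0) g.1 g.2.2 g.1.cadlag.1).measure

lemma measure_mono_of_monotonePath {ζ : ℝ≥0 → M} (h : MonotonePath ζ) {s t : ℝ≥0} (hst : s ≤ t) :
    (ζ s : Measure ℝ≥0) ≤ ζ t := by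
  have hclosed : ∀ F : Set ℝ≥0, IsClosed F → (ζ s : Measure ℝ≥0) F ≤ (ζ t : Measure ℝ≥0) F := by
    intro F hF
    refine ge_of_tendsto' (HasOuterApproxClosed.tendsto_lintegral_apprSeq hF
      (ζ t : Measure ℝ≥0)) fun n => ?_
    refine (HasOuterApproxClosed.measure_le_lintegral hF _ n).trans ?_
    let f : ℝ≥0 →ᵇ ℝ := BoundedContinuousFunction.ofNormedAddCommGroup
      (fun x => (hF.apprSeq n x : ℝ)) (by fun_prop) 1 (fun x => by
        have := HasOuterApproxClosed.apprSeq_apply_le_one hF n x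
        rw [Real.norm_of_nonneg (NNReal.coe_nonneg _)]
        exact_mod_cast this)
    have hf : ∀ x, 0 ≤ f x := fun x => (hF.apprSeq n x).coe_nonneg
    have hmono := h f hf hst
    have hint : ∀ ν : M, ∫⁻ x, (hF.apprSeq n x : ℝ≥0∞) ∂(ν : Measure ℝ≥0) =
        ENNReal.ofReal (∫ x, f x ∂(ν : Measure ℝ≥0)) := by
      intro ν
      rw [ofReal_integral_eq_lintegral_ofReal (f.integrable _) (Eventually.of_forall hf)]
      congr 1
      ext x
      exact (ENNReal.ofReal_coe_nnreal (p := hF.apprSeq n x)).symm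
    rw [hint, hint]
    exact ENNReal.ofReal_le_ofReal hmono
  refine Measure.le_iff.2 fun A hA => ?_
  rw [hA.measure_eq_iSup_isClosed_of_ne_top (measure_ne_top _ _)]
  exact iSup₂_le fun F hFA => iSup_le fun hF => (hclosed F hF).trans (measure_mono hFA)

lemma monotone_apply {ζ : ℝ≥0 → M} (h : MonotonePath ζ) (A : Set ℝ≥0) :
    Monotone fun t => (ζ t A : ℝ) := by
  intro s t hst
  have h1 := measure_mono_of_monotonePath h hst A
  rw [← FiniteMeasure.ennreal_coeFn_eq_coeFn_toMeasure,
    ← FiniteMeasure.ennreal_coeFn_eq_coeFn_toMeasure] at h1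
  exact_mod_cast h1

lemma isCadlag_tail (β : DMup) (x : ℝ≥0) : IsCadlag fun t => (β.1 t (Ioi x) : ℝ) := by
  refine ⟨fun t => ?_, fun t _ => ⟨_, (monotone_apply β.2 (Ioi x)).tendsto_nhdsLT t⟩⟩
  have hmass : Tendsto (fun s => ((β.1 s).mass : ℝ)) (𝓝[≥] t) (𝓝 ((β.1 t).mass : ℝ)) :=
    NNReal.tendsto_coe.2 (β.1.cadlag.1 t).mass
  have hup : Tendsto (fun s => (β.1 t (Ioi x) : ℝ) + ((β.1 s).mass - (β.1 t).mass)) (𝓝[≥] t)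
      (𝓝 (β.1 t (Ioi x) : ℝ)) := by
    have := (tendsto_const_nhds (x := (β.1 t (Ioi x) : ℝ))).add
      (hmass.sub (tendsto_const_nhds (x := ((β.1 t).mass : ℝ))))
    simpa using this
  refine tendsto_of_tendsto_of_tendsto_of_le_of_le' tendsto_const_nhds hup ?_ ?_
  · filter_upwards [self_mem_nhdsWithin] with s hs
    exact monotone_apply β.2 _ hs
  · filter_upwards [self_mem_nhdsWithin] with s hs
    have h1 := monotone_apply β.2 (Iic x) (show t ≤ s from hs)
    have e1 := congrArg NNReal.toReal (apply_add_compl (β.1 t) (measurableSet_Iic (a := x)))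
    have e2 := congrArg NNReal.toReal (apply_add_compl (β.1 s) (measurableSet_Iic (a := x)))
    rw [compl_Iic] at e1 e2
    push_cast at e1 e2
    simp only at h1
    linarith

/-- For a non-decreasing càdlàg path `β` of finite measures, the path `t ↦ β t (x, ∞)`. -/
def tail (β : DMup) (x : ℝ≥0) : DRup :=
  ⟨⟨fun t => (β.1 t (Ioi x) : ℝ), isCadlag_tail β x⟩,
    fun _ => NNReal.coe_nonneg _, monotone_apply β.2 (Ioi x)⟩

/-! ### The measure-valued Skorokhod problem -/

/-- `(ξ, β, ι)` solves the measure-valued Skorokhod problem for the data `(α, μ)`. -/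
structure SolvesMVSP (α : DMup) (μ : DRup) (ξ : D M) (β : DMup) (ι : DRup) : Prop where
  balance : ∀ x t : ℝ≥0, (ξ t (Iic x) : ℝ) = α.1 t (Iic x) - μ.1 t + β.1 t (Ioi x) + ι.1 t
  compl_tail : ∀ x : ℝ≥0, ∀ᵐ t ∂stieltjes (tail β x), ξ t (Iic x) = 0
  compl_idle : ∀ x : ℝ≥0, ∀ᵐ t ∂stieltjes ι, ξ t (Iic x) = 0
  total : ∀ t : ℝ≥0, ((β.1 t).mass : ℝ) + ι.1 t = μ.1 t

/-- The joint path `t ↦ (α t, μ t)`. -/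
def jointData (p : DMup × DRup) : D (M × ℝ) := p.1.1.pair p.2.1

/-- The joint path `t ↦ (ξ t, β t, ι t)`. -/
def jointSol (s : D M × DMup × DRup) : D (M × M × ℝ) := s.1.pair (s.2.1.1.pair s.2.2.1)

end MVSP

end

namespace MVSP

/-! ### Measures on the half-line and their distribution functions -/

/-! Write `p = (α, μ)`. For fixed `x`, the sum `β(x, ∞) + ι` is non-decreasing, keeps `α[0, x] - μ +
(β(x, ∞) + ι)` non-negative, and grows only while this quantity vanishes. It is thus the regulator
of a one-dimensional Skorokhod problem, and must be the running maximum `reg p (Iic x) t` of `(μ -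
α[0, x])⁺`. Letting `x → ∞` identifies `ι` as `reg p univ`. The solution is therefore explicit
(`IsSol`): `ξ[0, x] = α[0, x] - μ + reg p (Iic x)` and `β[0, x] = μ - reg p (Iic x)`.

Existence amounts to checking that these formulas define measures and admissible paths. All the
inequalities come from the monotonicity in time of `α` on every set. In particular, the time
increments of `reg p (Iic x)` decrease in `x` (`reg_sub_le_reg_sub`), which makes `β` a
non-decreasing path of measures. Complementarity holds since a running maximum is flat wherever it
is strictly above its driving path (`ae_stieltjes`, `IsSol.solves`); uniqueness is `add_le_of_ae`.

For continuity, the running maximum is 1-Lipschitz in the uniform norm and commutes with time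
changes. By monotonicity `α_t ≤ α_T` for `t ≤ T`, so one finite grid of non-atoms of `α_T` controls
the distribution functions at all times up to `T`. The time change that matches the data then
matches the solutions (`exists_levyClose_solution`, `tendsto_jointSol`).

For measurability, `tendsto_jointSol` shows that the map is continuous for the topology induced by
`jointData`. It remains to see that `jointData` is Borel, although it is not continuous for the
product topology: nearly simultaneous jumps of `α` and `μ` need not be matched by one time change. A
càdlàg path is the `J₁` limit of the step paths through its values on a grid (`tendsto_step`), and
for monotone paths these values are limits of time averages, which are `J₁` continuous
(`continuous_avg`, `continuous_avgM`). -/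

lemma stieltjes_Ioc (g : DRup) (a b : ℝ≥0) :
    stieltjes g (Ioc a b) = ENNReal.ofReal (g.1 b - g.1 a) := by
  simp [stieltjes]

lemma stieltjes_singleton {g : DRup} {t : ℝ≥0} (ht : 0 < t) :
    stieltjes g {t} = ENNReal.ofReal (g.1 t - Function.leftLim g.1 t) := by
  simp [stieltjes, ht.ne]

lemma stieltjes_Iic (g : DRup) (b : ℝ≥0) : stieltjes g (Iic b) = ENNReal.ofReal (g.1 b) := by
  have h0 : (StieltjesFunction.mk (R := ℝ≥0) g.1 g.2.2 g.1.cadlag.1).measure {0} = 0 := by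
    -- `0` has no left neighbours in `ℝ≥0`, so the left limit there takes its default value `g 0`
    -- and the jump is zero. The Dirac term alone carries the mass at `0`.
    rw [StieltjesFunction.measure_singleton, leftLim_eq_of_eq_bot]
    · simp
    · rw [show (Iio (0 : ℝ≥0)) = ∅ by ext; simp, nhdsWithin_empty]
  have hu : Iic b = {0} ∪ Ioc 0 b := by
    ext y
    rcases eq_or_ne y 0 with rfl | hy
    · simp
    · simp
  have h1 : (StieltjesFunction.mk (R := ℝ≥0) g.1 g.2.2 g.1.cadlag.1).measure (Iic b) =
      ENNReal.ofReal (g.1 b - g.1 0) := by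
    rw [hu, measure_union (by simp) measurableSet_Ioc, h0, zero_add,
      StieltjesFunction.measure_Ioc]
  rw [stieltjes, Measure.add_apply, h1]
  simp only [Measure.smul_apply, smul_eq_mul]
  rw [Measure.dirac_apply' _ measurableSet_Iic]
  simp only [mem_Iic, zero_le, indicator_of_mem, Pi.one_apply, mul_one]
  rw [← ENNReal.ofReal_add (g.2.1 0) (sub_nonneg.2 (g.2.2 zero_le))]
  simp

lemma monotone_Iic (ν : M) : Monotone fun x => (ν (Iic x) : ℝ) := fun _ _ h =>
  NNReal.coe_le_coe.2 (ν.apply_mono (Iic_subset_Iic.2 h))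

lemma Iic_le_mass (ν : M) (x : ℝ≥0) : (ν (Iic x) : ℝ) ≤ ν.mass :=
  NNReal.coe_le_coe.2 (ν.apply_le_mass _)

lemma Iic_add_Ioi (ν : M) (x : ℝ≥0) : (ν (Iic x) : ℝ) + ν (Ioi x) = ν.mass := by
  have := congrArg NNReal.toReal (apply_add_compl ν (measurableSet_Iic (a := x)))
  rwa [compl_Iic, NNReal.coe_add] at this

lemma M_ext {ν₁ ν₂ : M} (h : ∀ x, (ν₁ (Iic x) : ℝ) = ν₂ (Iic x)) : ν₁ = ν₂ := by
  have : (ν₁ : Measure ℝ≥0) = ν₂ := Measure.ext_of_Iic _ _ fun x =>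
    (ENNReal.toReal_eq_toReal_iff' (measure_ne_top _ _) (measure_ne_top _ _)).1 (h x)
  exact Subtype.ext this

lemma tendsto_Iic_nhdsGE (ν : M) (x : ℝ≥0) :
    Tendsto (fun y => (ν (Iic y) : ℝ)) (𝓝[≥] x) (𝓝 (ν (Iic x))) := by
  have h1 : Tendsto (fun y => (ν (Iic y) : ℝ)) (𝓝[>] x) (𝓝 (ν (Iic x))) := by
    have h := tendsto_measure_biInter_gt (μ := (ν : Measure ℝ≥0)) (s := fun y => Iic y) (a := x)
      (fun r _ => measurableSet_Iic.nullMeasurableSet)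
      (fun i j _ hij => Iic_subset_Iic.2 hij) ⟨x + 1, by simp, measure_ne_top _ _⟩
    have hI : (⋂ r > x, Iic r) = Iic x := by
      ext y
      simp only [gt_iff_lt, mem_iInter, mem_Iic]
      exact ⟨fun h => le_of_forall_gt_imp_ge_of_dense h, fun h r hr => h.trans hr.le⟩
    rw [hI] at h
    exact (ENNReal.tendsto_toReal (measure_ne_top _ _)).comp h
  have : ContinuousWithinAt (fun y => (ν (Iic y) : ℝ)) (Ioi x) x := h1
  exact (continuousWithinAt_Ioi_iff_Ici (f := fun y => (ν (Iic y) : ℝ))).1 this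

lemma tendsto_Iic_atTop (ν : M) : Tendsto (fun y => (ν (Iic y) : ℝ)) atTop (𝓝 ν.mass) := by
  have h := tendsto_measure_iUnion_atTop (μ := (ν : Measure ℝ≥0)) (s := fun y : ℝ≥0 => Iic y)
    (fun _ _ h => Iic_subset_Iic.2 h)
  have hu : (⋃ y : ℝ≥0, Iic y) = univ := by
    ext y
    simp only [mem_iUnion, mem_Iic, mem_univ, iff_true]
    exact ⟨y, le_rfl⟩
  rw [hu] at h
  exact (ENNReal.tendsto_toReal (measure_ne_top _ _)).comp h

/-- A non-negative, non-decreasing, right continuous and bounded function on `[0, ∞)` is the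
distribution function of a finite measure. -/
lemma exists_measure {F : ℝ≥0 → ℝ} (h0 : ∀ x, 0 ≤ F x) (hm : Monotone F)
    (hr : ∀ x, ContinuousWithinAt F (Ici x) x) {C : ℝ} (hC : ∀ x, F x ≤ C) :
    ∃ ν : M, ∀ x, (ν (Iic x) : ℝ) = F x := by
  let g : DRup := ⟨⟨F, hr, fun t _ => ⟨_, hm.tendsto_nhdsLT t⟩⟩, h0, hm⟩
  have hfin : IsFiniteMeasure (stieltjes g) := by
    refine ⟨lt_of_le_of_lt ?_ (ENNReal.ofReal_lt_top (r := C))⟩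
    have h := tendsto_measure_iUnion_atTop (μ := stieltjes g) (s := fun y : ℝ≥0 => Iic y)
      (fun _ _ h => Iic_subset_Iic.2 h)
    have hu : (⋃ y : ℝ≥0, Iic y) = univ := by
      ext y
      simp only [mem_iUnion, mem_Iic, mem_univ, iff_true]
      exact ⟨y, le_rfl⟩
    rw [hu] at h
    refine le_of_tendsto' h fun y => ?_
    simp only [Function.comp, stieltjes_Iic]
    exact ENNReal.ofReal_le_ofReal (hC y)
  refine ⟨⟨stieltjes g, hfin⟩, fun x => ?_⟩
  change (stieltjes g (Iic x)).toReal = F x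
  rw [stieltjes_Iic]
  exact ENNReal.toReal_ofReal (h0 x)

/-- If the difference of the distribution functions of two finite measures is non-negative and
non-decreasing, then the measures differ by a measure. -/
lemma exists_add_eq {ν₁ ν₂ : M} (h0 : ∀ x, (ν₁ (Iic x) : ℝ) ≤ ν₂ (Iic x))
    (hm : Monotone fun x => (ν₂ (Iic x) : ℝ) - ν₁ (Iic x)) : ∃ γ : M, ν₁ + γ = ν₂ := by
  obtain ⟨γ, hγ⟩ := exists_measure (F := fun x => (ν₂ (Iic x) : ℝ) - ν₁ (Iic x))
    (fun x => sub_nonneg.2 (h0 x)) hm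
    (fun x => (tendsto_Iic_nhdsGE ν₂ x).sub (tendsto_Iic_nhdsGE ν₁ x)) (C := ν₂.mass)
    (fun x => (sub_le_self _ (NNReal.coe_nonneg _)).trans (Iic_le_mass _ _))
  refine ⟨γ, M_ext fun x => ?_⟩
  have : ((ν₁ + γ : M) (Iic x) : ℝ) = ν₁ (Iic x) + γ (Iic x) := by
    rw [FiniteMeasure.coeFn_add]
    rfl
  rw [this, hγ]
  ring

lemma monotonePath_of_exists_add {ζ : ℝ≥0 → M} (h : ∀ s t, s ≤ t → ∃ γ : M, ζ s + γ = ζ t) :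
    MonotonePath ζ := by
  intro f hf s t hst
  obtain ⟨γ, hγ⟩ := h s t hst
  refine integral_mono_measure ?_ (Eventually.of_forall hf) (f.integrable _)
  rw [← hγ, FiniteMeasure.toMeasure_add]
  exact Measure.le_add_right le_rfl

lemma levyClose_of_abs_le {ν₁ ν₂ : M} {ε : ℝ≥0}
    (h : ∀ x, |(ν₁ (Iic x) : ℝ) - ν₂ (Iic x)| ≤ ε) : LevyClose ν₁ ν₂ ε := by
  intro x
  have h1 := abs_le.1 (h x)
  have m1 := monotone_Iic ν₁ (show x ≤ x + ε from le_self_add)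
  have m2 := monotone_Iic ν₂ (show x ≤ x + ε from le_self_add)
  simp only at m1 m2
  constructor
  · rw [← NNReal.coe_le_coe, NNReal.coe_add]
    linarith
  · rw [← NNReal.coe_le_coe, NNReal.coe_add]
    linarith

lemma dist_le_of_levyClose {ν₁ ν₂ : M} {ε : ℝ≥0} (hε : 0 < ε) (h : LevyClose ν₁ ν₂ ε) :
    dist ν₁ ν₂ ≤ ε :=
  NNReal.coe_le_coe.2 (levyDist_le hε h)

lemma levyClose_of_dist_lt {ν₁ ν₂ : M} {ε : ℝ≥0} (h : dist ν₁ ν₂ < ε) : LevyClose ν₁ ν₂ ε :=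
  levyClose_of_lt (NNReal.coe_lt_coe.1 h)

lemma tendsto_M_of_abs_le {ι : Type*} {L : Filter ι} {ζ : ι → M} {ν : M} {e : ι → ℝ}
    (he : Tendsto e L (𝓝 0)) (h : ∀ᶠ i in L, ∀ x, |(ζ i (Iic x) : ℝ) - ν (Iic x)| ≤ e i) :
    Tendsto ζ L (𝓝 ν) := by
  refine Metric.tendsto_nhds.2 fun ε hε => ?_
  lift ε to ℝ≥0 using hε.le
  have hε' : 0 < ε := by exact_mod_cast hε
  filter_upwards [h, he.eventually_le_const (show (0 : ℝ) < (ε / 2 : ℝ≥0) by positivity)]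
    with i hi hi'
  refine (dist_le_of_levyClose (half_pos hε') (levyClose_of_abs_le fun x =>
    (hi x).trans hi')).trans_lt ?_
  exact_mod_cast half_lt_self hε'

/-- A path of finite measures whose distribution functions are dominated by a non-decreasing
càdlàg function, uniformly in space, is càdlàg. -/
lemma isCadlag_of_abs_le {ζ : ℝ≥0 → M} {g : ℝ≥0 → ℝ} (hg : Monotone g) (hgc : IsCadlag g)
    (h : ∀ s t, s ≤ t → ∀ x, |(ζ t (Iic x) : ℝ) - ζ s (Iic x)| ≤ g t - g s) : IsCadlag ζ := by
  refine ⟨fun t => ?_, fun t ht => ?_⟩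
  · have he : Tendsto (fun s => g s - g t) (𝓝[≥] t) (𝓝 0) := by
      simpa using (hgc.1 t).tendsto.sub_const (g t)
    refine tendsto_M_of_abs_le he ?_
    filter_upwards [self_mem_nhdsWithin] with s hs
    exact h t s hs
  · have hne : (𝓝[<] t).NeBot := nhdsLT_neBot_of_exists_lt ⟨0, ht⟩
    obtain ⟨l, hl⟩ := hgc.2 t ht
    have hgl : ∀ s < t, g s ≤ l := fun s hs => by
      refine ge_of_tendsto hl ?_
      filter_upwards [Ioo_mem_nhdsLT hs] with u hu
      exact hg hu.1.le
    -- The Cauchy criterion for `g` at `t` from the left passes to every distribution function.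
    have hlim : ∀ x, ∃ c : ℝ, Tendsto (fun s => (ζ s (Iic x) : ℝ)) (𝓝[<] t) (𝓝 c) := by
      intro x
      refine cauchy_map_iff_exists_tendsto.1 ?_
      refine Metric.cauchy_iff.2 ⟨inferInstance, fun ε hε => ?_⟩
      have h1 : ∀ᶠ s in 𝓝[<] t, l - ε < g s := hl.eventually_const_lt (by linarith)
      obtain ⟨s, hs, hst⟩ := (h1.and self_mem_nhdsWithin).exists
      refine ⟨_, image_mem_map (Ico_mem_nhdsLT hst), ?_⟩
      have key : ∀ u v, u ∈ Ico s t → v ∈ Ico s t → u ≤ v →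
          dist (ζ u (Iic x) : ℝ) (ζ v (Iic x)) < ε := by
        intro u v hu hv huv
        rw [dist_comm, Real.dist_eq]
        have a1 := h u v huv x
        have a2 := hgl v hv.2
        have a3 := hg hu.1
        linarith
      rintro _ ⟨u, hu, rfl⟩ _ ⟨v, hv, rfl⟩
      rcases le_total u v with huv | huv
      · exact key u v hu hv huv
      · rw [dist_comm]; exact key v u hv hu huv
    choose F hF using hlim
    -- The rate `l - g s` does not depend on `x`. This uniformity makes `F` right continuous, and
    -- later gives convergence in the Lévy metric.
    have hclose : ∀ s < t, ∀ x, |(ζ s (Iic x) : ℝ) - F x| ≤ l - g s := by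
      intro s hs x
      have h1 : Tendsto (fun u => |(ζ s (Iic x) : ℝ) - ζ u (Iic x)|) (𝓝[<] t)
          (𝓝 |(ζ s (Iic x) : ℝ) - F x|) := (tendsto_const_nhds.sub (hF x)).abs
      refine le_of_tendsto h1 ?_
      filter_upwards [Ioo_mem_nhdsLT hs] with u hu
      rw [abs_sub_comm]
      linarith [h s u hu.1.le x, hgl u hu.2]
    have hF0 : ∀ x, 0 ≤ F x := fun x => ge_of_tendsto' (hF x) fun s => NNReal.coe_nonneg _
    have hFm : Monotone F := fun x y hxy =>
      le_of_tendsto_of_tendsto' (hF x) (hF y) fun s => monotone_Iic (ζ s) hxy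
    have hle : Tendsto (fun s => l - g s) (𝓝[<] t) (𝓝 0) := by
      simpa using hl.const_sub l
    have hFr : ∀ x, ContinuousWithinAt F (Ici x) x := by
      intro x
      refine Metric.tendsto_nhds.2 fun ε hε => ?_
      obtain ⟨s, hs, hst⟩ := ((hle.eventually_lt_const (show 0 < ε / 3 by positivity)).and
        self_mem_nhdsWithin).exists
      filter_upwards [Metric.tendsto_nhds.1 (tendsto_Iic_nhdsGE (ζ s) x) (ε / 3) (by positivity)]
        with y hy
      have a1 := abs_le.1 (hclose s hst x)
      have a2 := abs_le.1 (hclose s hst y)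
      rw [Real.dist_eq, abs_lt] at *
      constructor <;> linarith
    obtain ⟨ν, hν⟩ := exists_measure hF0 hFm hFr (C := (ζ 0).mass + (l - g 0)) (fun x => by
      have := abs_le.1 (hclose 0 ht x)
      linarith [Iic_le_mass (ζ 0) x])
    refine ⟨ν, tendsto_M_of_abs_le hle ?_⟩
    filter_upwards [self_mem_nhdsWithin] with s hs x
    rw [hν]
    exact hclose s hs x

/-! ### The regulator -/

/-- The running maximum of `(μ - α A)⁺` up to time `t`: the regulator of the one-dimensional
Skorokhod problem for the path `α A - μ`. -/
noncomputable def reg (p : DMup × DRup) (A : Set ℝ≥0) (t : ℝ≥0) : ℝ :=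
  sSup ((fun s => max (p.2.1 s - p.1.1 s A) 0) '' Iic t)

section reg

variable (p : DMup × DRup) {A B : Set ℝ≥0} {s t : ℝ≥0} {c : ℝ}

lemma reg_le_iff : reg p A t ≤ c ↔ 0 ≤ c ∧ ∀ s ≤ t, p.2.1 s - p.1.1 s A ≤ c := by
  have hb : BddAbove ((fun s => max (p.2.1 s - p.1.1 s A) 0) '' Iic t) := by
    refine ⟨p.2.1 t, ?_⟩
    rintro _ ⟨s, hs, rfl⟩
    refine max_le ?_ (p.2.2.1 t)
    exact (sub_le_self _ (NNReal.coe_nonneg _)).trans (p.2.2.2 hs)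
  rw [reg, csSup_le_iff hb ⟨_, mem_image_of_mem _ (mem_Iic.2 le_rfl)⟩]
  constructor
  · intro h
    exact ⟨(le_max_right _ _).trans (h _ (mem_image_of_mem _ (mem_Iic.2 le_rfl))),
      fun s hs => (le_max_left _ _).trans (h _ (mem_image_of_mem _ (mem_Iic.2 hs)))⟩
  · rintro ⟨h0, h⟩ _ ⟨s, hs, rfl⟩
    exact max_le (h s hs) h0

lemma reg_nonneg : 0 ≤ reg p A t := ((reg_le_iff p).1 le_rfl).1

lemma le_reg (hst : s ≤ t) : p.2.1 s - p.1.1 s A ≤ reg p A t := ((reg_le_iff p).1 le_rfl).2 s hst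

lemma reg_mono : Monotone (reg p A) := fun _ _ hst =>
  (reg_le_iff p).2 ⟨reg_nonneg p, fun _ hu => le_reg p (hu.trans hst)⟩

/-- Since `α A` is non-decreasing, the driving path `μ - α A` rises no faster than `μ`. -/
lemma reg_sub_le (hst : s ≤ t) : reg p A t - reg p A s ≤ p.2.1 t - p.2.1 s := by
  have hm := p.2.2.2 hst
  have h0 := reg_nonneg p (A := A) (t := s)
  rw [sub_le_iff_le_add, reg_le_iff]
  refine ⟨by linarith, fun u hu => ?_⟩
  rcases le_total u s with h | h
  · linarith [le_reg p (A := A) h]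
  · have h1 := monotone_apply p.1.2 A h
    have h2 := p.2.2.2 hu
    have h3 := le_reg p (A := A) (le_refl s)
    simp only at h1
    linarith

lemma reg_le : reg p A t ≤ p.2.1 t :=
  (reg_le_iff p).2 ⟨p.2.2.1 t, fun _ hs =>
    (sub_le_self _ (NNReal.coe_nonneg _)).trans (p.2.2.2 hs)⟩

lemma apply_sdiff (ν : M) (hA : MeasurableSet A) (h : A ⊆ B) :
    (ν (B \ A) : ℝ) = ν B - ν A := by
  have h1 := measure_sdiff_add_inter (μ := (ν : Measure ℝ≥0)) B hA
  rw [inter_eq_self_of_subset_right h] at h1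
  have h2 := congrArg ENNReal.toReal h1
  rw [ENNReal.toReal_add (measure_ne_top _ _) (measure_ne_top _ _)] at h2
  exact eq_sub_of_add_eq h2

lemma reg_anti (h : A ⊆ B) : reg p B t ≤ reg p A t := by
  refine (reg_le_iff p).2 ⟨reg_nonneg p, fun s hs => le_trans ?_ (le_reg p hs)⟩
  have : (p.1.1 s A : ℝ) ≤ p.1.1 s B := NNReal.coe_le_coe.2 (FiniteMeasure.apply_mono _ h)
  linarith

/-- The two driving paths differ at time `s` by `α_s (B \ A)`, which is at most `α_t (B \ A)`. -/
lemma reg_le_add (hA : MeasurableSet A) (h : A ⊆ B) :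
    reg p A t ≤ reg p B t + (p.1.1 t B - p.1.1 t A) := by
  have h0 := reg_nonneg p (A := B) (t := t)
  rw [reg_le_iff, ← apply_sdiff _ hA h]
  refine ⟨by positivity, fun s hs => ?_⟩
  have h1 := monotone_apply p.1.2 (B \ A) hs
  have h2 := le_reg p (A := B) hs
  have h3 := apply_sdiff (p.1.1 s) hA h
  simp only at h1
  linarith

/-- For `u ∈ [s, t]`, `μ_u - α_u B` is at most `reg p A t - α_s (B \ A)`, and `reg_le_add` at time
`s` bounds `α_s (B \ A)` below by `reg p A s - reg p B s`. This is what makes the increments of `β`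
measures. -/
lemma reg_sub_le_reg_sub (hA : MeasurableSet A) (h : A ⊆ B) (hst : s ≤ t) :
    reg p B t - reg p B s ≤ reg p A t - reg p A s := by
  have h1 := reg_mono p (A := A) hst
  rw [sub_le_iff_le_add, reg_le_iff]
  refine ⟨by linarith [reg_nonneg p (A := B) (t := s)], fun u hu => ?_⟩
  rcases le_total u s with hus | hus
  · linarith [le_reg p (A := B) hus]
  · have h2 := reg_le_add p (t := s) hA h
    have h3 := monotone_apply p.1.2 (B \ A) hus
    simp only [apply_sdiff _ hA h] at h3
    linarith [le_reg p (A := A) hu]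

lemma isCadlag_mass (α : DMup) : IsCadlag fun t => ((α.1 t).mass : ℝ) := by
  refine ⟨fun t => NNReal.tendsto_coe.2 (α.1.cadlag.1 t).mass, fun t ht => ?_⟩
  obtain ⟨l, hl⟩ := α.1.cadlag.2 t ht
  exact ⟨_, NNReal.tendsto_coe.2 hl.mass⟩

lemma monotone_mass (α : DMup) : Monotone fun t => ((α.1 t).mass : ℝ) := monotone_apply α.2 univ

lemma apply_sub_apply_le (α : DMup) (hst : s ≤ t) (hA : MeasurableSet A) :
    (α.1 t A : ℝ) - α.1 s A ≤ (α.1 t).mass - (α.1 s).mass := by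
  have h1 := monotone_apply α.2 (univ \ A) hst
  simp only [apply_sdiff _ hA (subset_univ A)] at h1
  change ((α.1 s).mass : ℝ) - _ ≤ (α.1 t).mass - _ at h1
  linarith

/-- The right continuity of the driving path. -/
lemma eventually_sub_le (hc : p.2.1 t - p.1.1 t A < c) :
    ∃ u > t, ∀ s, t ≤ s → s ≤ u → p.2.1 s - p.1.1 s A ≤ c := by
  have h1 := (p.2.1.cadlag.1 t).tendsto.eventually_lt_const
    (show p.2.1 t < c + p.1.1 t A by linarith)
  obtain ⟨u, hu, h⟩ := (mem_nhdsGE_iff_exists_Icc_subset).1 h1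
  refine ⟨u, hu, fun s hs hsu => ?_⟩
  have h2 : p.2.1 s < c + p.1.1 t A := h ⟨hs, hsu⟩
  have h3 := monotone_apply p.1.2 A hs
  simp only at h3
  linarith

/-- A driving path strictly below its running maximum stays below it for a while, by right
continuity. With the next two lemmas, this says that the regulator does not charge such times. -/
lemma exists_reg_eq (h : p.2.1 t - p.1.1 t A < reg p A t) :
    ∃ u > t, reg p A u = reg p A t := by
  obtain ⟨u, hu, hs⟩ := eventually_sub_le p h
  refine ⟨u, hu, le_antisymm ((reg_le_iff p).2 ⟨reg_nonneg p, fun s hsu => ?_⟩)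
    (reg_mono p hu.le)⟩
  rcases le_total s t with h | h
  · exact le_reg p h
  · exact hs s h hsu

lemma exists_reg_le_add (h : p.2.1 t - p.1.1 t A < reg p A t) (ht : 0 < t) {ε : ℝ} (hε : 0 < ε) :
    ∃ s < t, reg p A t ≤ reg p A s + ε := by
  by_contra! hcon
  -- If the regulator jumped by more than `ε` at `t`, the maximum up to `t` would be attained at `t`
  -- itself, against `h`.
  have h1 : reg p A t ≤ max (p.2.1 t - p.1.1 t A) (reg p A t - ε) := by
    refine (reg_le_iff p).2 ⟨?_, fun s hs => ?_⟩
    · exact le_max_of_le_right (by linarith [hcon 0 ht, reg_nonneg p (A := A) (t := 0)])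
    · rcases hs.eq_or_lt with rfl | hs
      · exact le_max_left _ _
      · exact le_max_of_le_right (by linarith [hcon s hs, le_reg p (A := A) (le_refl s)])
  rcases le_max_iff.1 h1 with h2 | h2 <;> linarith

lemma reg_zero_eq (h : p.2.1 0 - p.1.1 0 A < reg p A 0) : reg p A 0 = 0 := by
  refine le_antisymm ?_ (reg_nonneg p)
  by_contra! hpos
  have h1 : reg p A 0 ≤ max (p.2.1 0 - p.1.1 0 A) 0 :=
    (reg_le_iff p).2 ⟨le_max_right _ _, fun s hs => by
      rw [le_zero_iff.1 hs]; exact le_max_left _ _⟩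
  rcases le_max_iff.1 h1 with h2 | h2 <;> linarith

lemma tendsto_reg_nhdsGE (x : ℝ≥0) :
    Tendsto (fun y => reg p (Iic y) t) (𝓝[≥] x) (𝓝 (reg p (Iic x) t)) := by
  have h := (tendsto_Iic_nhdsGE (p.1.1 t) x).const_sub (p.1.1 t (Iic x) : ℝ)
  have h1 := h.const_add (reg p (Iic x) t)
  simp only [sub_self, add_zero] at h1
  refine tendsto_of_tendsto_of_tendsto_of_le_of_le' h1 tendsto_const_nhds ?_ ?_
  · filter_upwards [self_mem_nhdsWithin] with y hy
    linarith [reg_le_add p (t := t) measurableSet_Iic (Iic_subset_Iic.2 (mem_Ici.1 hy))]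
  · filter_upwards [self_mem_nhdsWithin] with y hy
    exact reg_anti p (Iic_subset_Iic.2 hy)

lemma tendsto_reg_atTop : Tendsto (fun y => reg p (Iic y) t) atTop (𝓝 (reg p univ t)) := by
  have h := (tendsto_Iic_atTop (p.1.1 t)).const_sub ((p.1.1 t).mass : ℝ)
  have h1 := h.const_add (reg p univ t)
  simp only [sub_self, add_zero] at h1
  refine tendsto_of_tendsto_of_tendsto_of_le_of_le tendsto_const_nhds h1 (fun y => ?_) (fun y => ?_)
  · exact reg_anti p (subset_univ _)
  · exact reg_le_add p (t := t) measurableSet_Iic (subset_univ (Iic y))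

lemma reg_le_reg_univ_add (x : ℝ≥0) :
    reg p (Iic x) t ≤ reg p univ t + ((p.1.1 t).mass - p.1.1 t (Iic x)) :=
  reg_le_add p (t := t) measurableSet_Iic (subset_univ (Iic x))

end reg

/-! ### The explicit solution -/

/-- The explicit form of the solution of the measure-valued Skorokhod problem. -/
structure IsSol (p : DMup × DRup) (s : D M × DMup × DRup) : Prop where
  queue : ∀ x t, (s.1 t (Iic x) : ℝ) = p.1.1 t (Iic x) - p.2.1 t + reg p (Iic x) t
  served : ∀ x t, (s.2.1.1 t (Iic x) : ℝ) = p.2.1 t - reg p (Iic x) t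
  idle : ∀ t, s.2.2.1 t = reg p univ t

lemma D_ext {S : Type*} [TopologicalSpace S] {x y : D S} (h : ∀ t, x t = y t) : x = y := by
  cases x; cases y; congr; exact funext h

lemma IsSol.unique {p : DMup × DRup} {s s' : D M × DMup × DRup} (h : IsSol p s)
    (h' : IsSol p s') : s = s' := by
  refine Prod.ext (D_ext fun t => M_ext fun x => ?_) (Prod.ext (Subtype.ext (D_ext fun t =>
    M_ext fun x => ?_)) (Subtype.ext (D_ext fun t => ?_)))
  · rw [h.queue, h'.queue]
  · rw [h.served, h'.served]
  · rw [h.idle, h'.idle]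

lemma IsSol.mass {p : DMup × DRup} {s : D M × DMup × DRup} (h : IsSol p s) (t : ℝ≥0) :
    ((s.2.1.1 t).mass : ℝ) = p.2.1 t - reg p univ t := by
  refine tendsto_nhds_unique (tendsto_Iic_atTop _) ?_
  simp_rw [h.served]
  exact (tendsto_reg_atTop p).const_sub _

lemma IsSol.queue_mass {p : DMup × DRup} {s : D M × DMup × DRup} (h : IsSol p s) (t : ℝ≥0) :
    ((s.1 t).mass : ℝ) = (p.1.1 t).mass - p.2.1 t + reg p univ t := by
  refine tendsto_nhds_unique (tendsto_Iic_atTop _) ?_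
  simp_rw [h.queue]
  exact ((tendsto_Iic_atTop _).sub_const _).add (tendsto_reg_atTop p)

lemma exists_isSol (p : DMup × DRup) : ∃ s, IsSol p s := by
  have hβ : ∀ t, ∃ ν : M, ∀ x, (ν (Iic x) : ℝ) = p.2.1 t - reg p (Iic x) t := fun t =>
    exists_measure (fun x => sub_nonneg.2 (reg_le p))
      (fun x y hxy => sub_le_sub_left (reg_anti p (Iic_subset_Iic.2 hxy)) _)
      (fun x => (tendsto_reg_nhdsGE p x).const_sub _)
      (fun x => sub_le_self _ (reg_nonneg p))
  have hξ : ∀ t, ∃ ν : M, ∀ x,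
      (ν (Iic x) : ℝ) = p.1.1 t (Iic x) - p.2.1 t + reg p (Iic x) t := fun t =>
    exists_measure (fun x => by linarith [le_reg p (A := Iic x) (le_refl t)])
      (fun x y hxy => by
        have := reg_le_add p (t := t) measurableSet_Iic (Iic_subset_Iic.2 hxy)
        linarith)
      (fun x => ((tendsto_Iic_nhdsGE _ x).sub_const _).add (tendsto_reg_nhdsGE p x))
      (C := (p.1.1 t).mass) (fun x => by
        linarith [reg_le p (A := Iic x) (t := t), Iic_le_mass (p.1.1 t) x])
  choose β hβ using hβ
  choose ξ hξ using hξ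
  -- The increments of `β` are dominated by those of `μ`, and the increments of `ξ` below by those
  -- of the total mass of `α` plus `μ`.
  have hβc : IsCadlag β := isCadlag_of_abs_le p.2.2.2 p.2.1.cadlag fun s t hst x => by
    have h1 := reg_sub_le p (A := Iic x) hst
    have h2 := reg_mono p (A := Iic x) hst
    have h3 := p.2.2.2 hst
    rw [hβ, hβ, abs_le]
    constructor <;> linarith
  have hgc : IsCadlag fun t => ((p.1.1 t).mass : ℝ) + p.2.1 t := by
    refine ⟨fun t => ((isCadlag_mass p.1).1 t).add (p.2.1.cadlag.1 t), fun t ht => ?_⟩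
    obtain ⟨l, hl⟩ := (isCadlag_mass p.1).2 t ht
    obtain ⟨l', hl'⟩ := p.2.1.cadlag.2 t ht
    exact ⟨_, hl.add hl'⟩
  have hξc : IsCadlag ξ := isCadlag_of_abs_le ((monotone_mass p.1).add p.2.2.2) hgc
    fun s t hst x => by
      have h1 := reg_sub_le p (A := Iic x) hst
      have h2 := reg_mono p (A := Iic x) hst
      have h3 := p.2.2.2 hst
      have h4 := apply_sub_apply_le p.1 hst (measurableSet_Iic (a := x))
      have h5 := monotone_apply p.1.2 (Iic x) hst
      simp only at h5
      rw [hξ, hξ, abs_le]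
      constructor <;> linarith
  have hβm : MonotonePath β := monotonePath_of_exists_add fun s t hst =>
    exists_add_eq (fun x => by rw [hβ, hβ]; linarith [reg_sub_le p (A := Iic x) hst])
      (fun x y hxy => by
        simp only [hβ]
        linarith [reg_sub_le_reg_sub p measurableSet_Iic (Iic_subset_Iic.2 hxy) hst])
  have hιc : IsCadlag (reg p univ) := by
    refine ⟨fun t => ?_, fun t _ => ⟨_, (reg_mono p).tendsto_nhdsLT t⟩⟩
    have h : Tendsto (fun s => reg p univ t + (p.2.1 s - p.2.1 t)) (𝓝[≥] t) (𝓝 (reg p univ t)) := by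
      simpa using ((p.2.1.cadlag.1 t).tendsto.sub_const (p.2.1 t)).const_add (reg p univ t)
    refine tendsto_of_tendsto_of_tendsto_of_le_of_le' tendsto_const_nhds h ?_ ?_
    · filter_upwards [self_mem_nhdsWithin] with s hs
      exact reg_mono p hs
    · filter_upwards [self_mem_nhdsWithin] with s hs
      linarith [reg_sub_le p (A := univ) hs]
  exact ⟨(⟨ξ, hξc⟩, ⟨⟨β, hβc⟩, hβm⟩, ⟨⟨reg p univ, hιc⟩, fun _ => reg_nonneg p, reg_mono p⟩),
    fun x t => hξ t x, fun x t => hβ t x, fun _ => rfl⟩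

/-- The points at which a Stieltjes measure is flat to the right and has no jump are negligible. -/
lemma ae_stieltjes {g : DRup} {P : ℝ≥0 → Prop} (hr : ∀ t, ¬ P t → ∃ u > t, g.1 u = g.1 t)
    (hl : ∀ t, ¬ P t → 0 < t → ∀ ε > 0, ∃ s < t, g.1 t ≤ g.1 s + ε)
    (h0 : ¬ P 0 → g.1 0 = 0) : ∀ᵐ t ∂stieltjes g, P t := by
  have hnull : ∀ t, ¬ P t → ∀ u, g.1 u = g.1 t → stieltjes g (Icc t u) = 0 := by
    intro t ht u hu
    rcases eq_or_ne t 0 with rfl | hpos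
    · refine measure_mono_null Icc_subset_Iic_self ?_
      rw [stieltjes_Iic, hu, h0 ht, ENNReal.ofReal_zero]
    · refine le_antisymm (ENNReal.le_of_forall_pos_le_add fun ε hε _ => ?_) zero_le
      obtain ⟨s, hs, hse⟩ := hl t ht (pos_iff_ne_zero.2 hpos) ε hε
      refine (measure_mono (show Icc t u ⊆ Ioc s u from
        fun y hy => ⟨hs.trans_le hy.1, hy.2⟩)).trans ?_
      rw [stieltjes_Ioc, zero_add, ENNReal.ofReal_le_iff_le_toReal ENNReal.coe_ne_top]
      simp only [ENNReal.coe_toReal]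
      linarith
  choose! u hu hgu using hr
  have hflat : ∀ t, ¬ P t → ∀ q ∈ Icc t (u t), g.1 q = g.1 t := fun t ht q hq =>
    le_antisymm ((g.2.2 hq.2).trans (hgu t ht).le) (g.2.2 hq.1)
  -- Every bad time `t` starts a flat stretch containing a point of `Q`, so it is enough to treat
  -- the bad times whose stretch contains a given `q`.
  obtain ⟨Q, hQc, hQd⟩ := TopologicalSpace.exists_countable_dense ℝ≥0
  have hcover : {t | ¬ P t} ⊆ ⋃ q ∈ Q, {t | ¬ P t ∧ q ∈ Ioo t (u t)} := by
    intro t ht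
    obtain ⟨q, hq, hqt⟩ := hQd.exists_mem_open isOpen_Ioo (nonempty_Ioo.2 (hu t ht))
    exact mem_biUnion hq ⟨ht, hqt⟩
  refine measure_mono_null hcover ((measure_biUnion_null_iff hQc).2 fun q _ => ?_)
  set E := {t | ¬ P t ∧ q ∈ Ioo t (u t)} with hE
  have hEq : ∀ t ∈ E, stieltjes g (Icc t q) = 0 := fun t ht =>
    hnull t ht.1 q (hflat t ht.1 q (Ioo_subset_Icc_self ht.2))
  rcases E.eq_empty_or_nonempty with hemp | hne
  · rw [hemp, measure_empty]
  -- `E` is covered by `[inf E, q]` if the infimum is attained, and otherwise by the countably many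
  -- null intervals `[v n, q]` with `v n` decreasing to it.
  obtain ⟨v, -, -, hv, hvE⟩ :=
    (isGLB_csInf hne (OrderBot.bddBelow E)).exists_seq_antitone_tendsto hne
  by_cases hinf : sInf E ∈ E
  · refine measure_mono_null (fun t ht => ?_) (hEq _ hinf)
    exact ⟨csInf_le (OrderBot.bddBelow E) ht, ht.2.1.le⟩
  · refine measure_mono_null (fun t ht => ?_)
      (measure_iUnion_null fun n => hEq _ (hvE n))
    have hlt : sInf E < t := lt_of_le_of_ne (csInf_le (OrderBot.bddBelow E) ht) fun h =>
      hinf (h ▸ ht)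
    obtain ⟨n, hn⟩ := (hv.eventually_le_const hlt).exists
    exact mem_iUnion.2 ⟨n, hn, ht.2.1.le⟩

lemma IsSol.tail_add {p : DMup × DRup} {s : D M × DMup × DRup} (h : IsSol p s) (x t : ℝ≥0) :
    (s.2.1.1 t (Ioi x) : ℝ) + s.2.2.1 t = reg p (Iic x) t := by
  have h1 := Iic_add_Ioi (s.2.1.1 t) x
  rw [h.served, h.mass] at h1
  rw [h.idle]
  linarith

lemma IsSol.solves {p : DMup × DRup} {s : D M × DMup × DRup} (h : IsSol p s) :
    SolvesMVSP p.1 p.2 s.1 s.2.1 s.2.2 := by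
  -- Both summands are non-decreasing, so each inherits the flatness of the sum. Applied with `β(x,
  -- ∞)` and `ι` in the two orders.
  have key : ∀ (x : ℝ≥0) (g g' : DRup), (∀ t, g.1 t + g'.1 t = reg p (Iic x) t) →
      ∀ᵐ t ∂stieltjes g, s.1 t (Iic x) = 0 := by
    intro x g g' hg
    have hlt : ∀ t, ¬ s.1 t (Iic x) = 0 → p.2.1 t - p.1.1 t (Iic x) < reg p (Iic x) t := by
      intro t ht
      have h1 : (0 : ℝ) < s.1 t (Iic x) := NNReal.coe_pos.2 (pos_iff_ne_zero.2 ht)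
      rw [h.queue] at h1
      linarith
    refine ae_stieltjes (fun t ht => ?_) (fun t ht htp ε hε => ?_) (fun ht => ?_)
    · obtain ⟨u, hu, he⟩ := exists_reg_eq p (hlt t ht)
      refine ⟨u, hu, ?_⟩
      rw [← hg, ← hg] at he
      linarith [g.2.2 hu.le, g'.2.2 hu.le]
    · obtain ⟨u, hu, he⟩ := exists_reg_le_add p (hlt t ht) htp hε
      refine ⟨u, hu, ?_⟩
      rw [← hg, ← hg] at he
      linarith [g.2.2 hu.le, g'.2.2 hu.le]
    · have he := reg_zero_eq p (hlt 0 ht)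
      rw [← hg] at he
      linarith [g.2.1 0, g'.2.1 0]
  refine ⟨fun x t => ?_, fun x => ?_, fun x => ?_, fun t => ?_⟩
  · rw [add_assoc, h.tail_add, h.queue]
  · exact key x (tail s.2.1 x) s.2.2 (h.tail_add x)
  · exact key x s.2.2 (tail s.2.1 x) fun t => by rw [add_comm]; exact h.tail_add x t
  · rw [h.mass, h.idle]; ring

/-- In one dimension, the complementarity condition forces the regulator to be the running
maximum. -/
lemma add_le_of_ae {g g' : DRup} {z : ℝ≥0 → ℝ≥0} {t : ℝ≥0} {c : ℝ} (hc : 0 ≤ c)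
    (hz : ∀ s ≤ t, c < g.1 s + g'.1 s → z s ≠ 0) (hg : ∀ᵐ s ∂stieltjes g, z s = 0)
    (hg' : ∀ᵐ s ∂stieltjes g', z s = 0) : g.1 t + g'.1 t ≤ c := by
  by_contra! hcon
  have hnull : ∀ {k : DRup}, (∀ᵐ s ∂stieltjes k, z s = 0) → ∀ {E : Set ℝ≥0},
      (∀ s ∈ E, s ≤ t ∧ c < g.1 s + g'.1 s) → stieltjes k E = 0 := fun hk E hE =>
    measure_mono_null (fun s hs => hz s (hE s hs).1 (hE s hs).2) hk
  set B := {s | s ≤ t ∧ g.1 s + g'.1 s ≤ c} with hB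
  have hBt : ∀ s ∈ B, s ≤ t := fun s hs => hs.1
  rcases B.eq_empty_or_nonempty with hemp | hne
  -- If the sum exceeds `c` on all of `[0, t]`, neither measure charges `[0, t]`, the mass at `0`
  -- included, so the sum is at most `0` at `t`.
  · have hle : ∀ {k : DRup}, (∀ᵐ s ∂stieltjes k, z s = 0) → k.1 t ≤ 0 := by
      intro k hk
      have := hnull hk (E := Iic t) fun s hs => ⟨hs, by
        by_contra! h
        exact hemp.subset ⟨hs, h⟩⟩
      rwa [stieltjes_Iic, ENNReal.ofReal_eq_zero] at this
    linarith [hle hg, hle hg']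
  -- After `σ` neither measure charges anything up to `t`, so the sum already exceeds `c` at `σ`.
  -- Then `{σ}` is not charged either, hence there is no jump at `σ`; but the left limit there is at
  -- most `c`.
  set σ := sSup B with hσ
  have hbdd : BddAbove B := ⟨t, hBt⟩
  have hσt : σ ≤ t := csSup_le hne hBt
  have hgt : ∀ s, σ < s → s ≤ t → c < g.1 s + g'.1 s := by
    intro s hs hst
    by_contra! h
    exact hs.not_ge (le_csSup hbdd ⟨hst, h⟩)
  have hle : ∀ {k : DRup}, (∀ᵐ s ∂stieltjes k, z s = 0) → k.1 t ≤ k.1 σ := by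
    intro k hk
    have := hnull hk (E := Ioc σ t) fun s hs => ⟨hs.2, hgt s hs.1 hs.2⟩
    rwa [stieltjes_Ioc, ENNReal.ofReal_eq_zero, sub_nonpos] at this
  have hσc : c < g.1 σ + g'.1 σ := by linarith [hle hg, hle hg']
  have hex : ∀ s < σ, g.1 s + g'.1 s ≤ c := by
    intro s hs
    obtain ⟨b, hb, hsb⟩ := exists_lt_of_lt_csSup hne hs
    linarith [g.2.2 hsb.le, g'.2.2 hsb.le, hb.2]
  have hpos : 0 < σ := by
    obtain ⟨b, hb⟩ := hne
    refine zero_le.trans_lt (lt_of_le_of_ne (le_csSup hbdd hb) fun h => ?_)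
    change b = σ at h
    rw [← h] at hσc
    linarith [hb.2]
  have hleft : ∀ {k : DRup}, (∀ᵐ s ∂stieltjes k, z s = 0) → k.1 σ ≤ Function.leftLim k.1 σ := by
    intro k hk
    have := hnull hk (E := {σ}) fun s hs => by rw [hs]; exact ⟨hσt, hσc⟩
    rwa [stieltjes_singleton hpos, ENNReal.ofReal_eq_zero, sub_nonpos] at this
  have hne' : (𝓝[<] σ).NeBot := nhdsLT_neBot_of_exists_lt ⟨0, hpos⟩
  have hlim := (g.2.2.tendsto_leftLim σ).add (g'.2.2.tendsto_leftLim σ)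
  have := le_of_tendsto hlim (by
    filter_upwards [self_mem_nhdsWithin] with s hs
    exact hex s hs)
  linarith [hleft hg, hleft hg']

lemma isSol_of_solves {p : DMup × DRup} {s : D M × DMup × DRup}
    (h : SolvesMVSP p.1 p.2 s.1 s.2.1 s.2.2) : IsSol p s := by
  have hreg : ∀ x t, (s.2.1.1 t (Ioi x) : ℝ) + s.2.2.1 t = reg p (Iic x) t := by
    intro x t
    refine le_antisymm ?_ ((reg_le_iff p).2 ⟨?_, fun u hu => ?_⟩)
    -- With the level `c = reg p (Iic x) t`: a sum above `c` at `u ≤ t` exceeds `μ_u - α_u[0, x]`,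
    -- so the balance equation forces `ξ_u[0, x] > 0`.
    · refine add_le_of_ae (g := tail s.2.1 x) (g' := s.2.2) (z := fun t => s.1 t (Iic x))
        (reg_nonneg p) (fun u hu hlt => ?_) (h.compl_tail x) (h.compl_idle x)
      change _ < (s.2.1.1 u (Ioi x) : ℝ) + s.2.2.1 u at hlt
      have h1 := h.balance x u
      have h2 := le_reg p (A := Iic x) hu
      intro h0
      rw [h0] at h1
      simp only [NNReal.coe_zero] at h1
      linarith
    · exact add_nonneg (NNReal.coe_nonneg _) (s.2.2.2.1 t)
    · have h1 := h.balance x u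
      have h2 : (0 : ℝ) ≤ s.1 u (Iic x) := NNReal.coe_nonneg _
      have h3 := monotone_apply s.2.1.2 (Ioi x) hu
      have h4 := s.2.2.2.2 hu
      simp only at h3
      linarith
  have hserved : ∀ x t, (s.2.1.1 t (Iic x) : ℝ) = p.2.1 t - reg p (Iic x) t := by
    intro x t
    linarith [hreg x t, Iic_add_Ioi (s.2.1.1 t) x, h.total t]
  refine ⟨fun x t => ?_, hserved, fun t => ?_⟩
  · linarith [hreg x t, h.balance x t]
  -- `x → ∞` yields the total mass of `β`, and condition 4 then yields `ι`.
  · have h1 : Tendsto (fun x => (s.2.1.1 t (Iic x) : ℝ)) atTop (𝓝 (p.2.1 t - reg p univ t)) := by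
      simp_rw [hserved]
      exact (tendsto_reg_atTop p).const_sub _
    linarith [h.total t, tendsto_nhds_unique (tendsto_Iic_atTop (s.2.1.1 t)) h1]

/-- The measure-valued Skorokhod map. -/
noncomputable def skorokhodMap (p : DMup × DRup) : D M × DMup × DRup := (exists_isSol p).choose

lemma isSol_skorokhodMap (p : DMup × DRup) : IsSol p (skorokhodMap p) :=
  (exists_isSol p).choose_spec

lemma solves_iff (p : DMup × DRup) (s : D M × DMup × DRup) :
    SolvesMVSP p.1 p.2 s.1 s.2.1 s.2.2 ↔ s = skorokhodMap p :=
  ⟨fun h => (isSol_of_solves h).unique (isSol_skorokhodMap p),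
    fun h => h ▸ (isSol_skorokhodMap p).solves⟩

/-! ### Stability of the solution -/

lemma exists_nonatom (ν : M) {a b : ℝ≥0} (hab : a < b) : ∃ c, a < c ∧ c < b ∧ ν {c} = 0 := by
  have hcount : {y : ℝ≥0 | 0 < (ν : Measure ℝ≥0) {y}}.Countable :=
    Measure.countable_meas_pos_of_disjoint_iUnion (μ := (ν : Measure ℝ≥0))
      (As := fun y : ℝ≥0 => {y}) (fun y => measurableSet_singleton y)
      (fun y z hyz => by simpa [Function.onFun] using hyz)
  obtain ⟨r, hr, hr1, hr2⟩ := ((hcount.image ((↑) : ℝ≥0 → ℝ)).dense_compl ℝ).exists_between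
    (NNReal.coe_lt_coe.2 hab)
  lift r to ℝ≥0 using a.coe_nonneg.trans hr1.le
  refine ⟨r, by exact_mod_cast hr1, by exact_mod_cast hr2, ?_⟩
  rw [FiniteMeasure.null_iff_toMeasure_null]
  by_contra hne
  exact hr ⟨r, pos_iff_ne_zero.2 hne, rfl⟩

/-- Two finite measures whose distribution functions are close on a fine grid are close in the
Lévy distance. -/
lemma levyClose_of_grid {ν₁ ν₂ : M} {e : ℝ≥0} (he : 0 < e) {y : ℕ → ℝ≥0} {N : ℕ}
    (hy : ∀ j, j * e < y j ∧ y j < (j + 1) * e)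
    (hclose : ∀ j ≤ N + 1, |(ν₁ (Iic (y j)) : ℝ) - ν₂ (Iic (y j))| ≤ e)
    (hmass : |(ν₁.mass : ℝ) - ν₂.mass| ≤ e) (htail : (ν₂.mass : ℝ) ≤ ν₂ (Iic (y N)) + e) :
    LevyClose ν₁ ν₂ (2 * e) := by
  intro x
  have hpos : (0 : ℝ) ≤ e := e.coe_nonneg
  rw [← NNReal.coe_le_coe, ← NNReal.coe_le_coe]
  push_cast
  -- For `x` in cell `j ≤ N`, the grid point `y (j + 1)` lies in `[x, x + 2 e]`, whence the factor 2
  -- and the range up to `N + 1`. Further right, the total masses are compared with the values at `y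
  -- N`.
  set j := ⌊x / e⌋₊ with hj
  have hj1 : (j : ℝ≥0) * e ≤ x := (le_div_iff₀ he).1 (Nat.floor_le zero_le)
  have hj2 : x < (j + 1) * e := by
    rw [← div_lt_iff₀ he]
    exact Nat.lt_floor_add_one (x / e)
  have hx1 := monotone_Iic ν₁ (show x ≤ x + 2 * e from le_self_add)
  have hx2 := monotone_Iic ν₂ (show x ≤ x + 2 * e from le_self_add)
  simp only at hx1 hx2
  rw [abs_le] at hmass
  by_cases hN : j ≤ N
  · have h := abs_le.1 (hclose (j + 1) (by omega))
    have hy1 : x ≤ y (j + 1) := by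
      refine hj2.le.trans ?_
      have := (hy (j + 1)).1
      push_cast at this
      exact this.le
    have hy2 : y (j + 1) ≤ x + 2 * e := by
      refine (hy (j + 1)).2.le.trans ?_
      push_cast
      calc ((j : ℝ≥0) + 1 + 1) * e = j * e + 2 * e := by ring
        _ ≤ _ := by gcongr
    have m1 := monotone_Iic ν₁ hy1
    have m2 := monotone_Iic ν₂ hy1
    have m3 := monotone_Iic ν₁ hy2
    have m4 := monotone_Iic ν₂ hy2
    simp only at m1 m2 m3 m4
    constructor <;> linarith
  · have hyx : y N ≤ x := by
      refine (hy N).2.le.trans (le_trans ?_ hj1)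
      gcongr
      exact_mod_cast (not_le.1 hN)
    have h := abs_le.1 (hclose N (by omega))
    have m1 := monotone_Iic ν₁ hyx
    have m2 := monotone_Iic ν₂ hyx
    have b1 := Iic_le_mass ν₁ x
    have b2 := Iic_le_mass ν₂ x
    simp only at m1 m2
    constructor <;> linarith

/-- Lévy closeness gives closeness of distribution functions around points with small mass. -/
lemma abs_Iic_sub_le {a a' ν : M} {δ : ℝ≥0} {κ : ℝ} (h : LevyClose a' a δ)
    (hν : ∀ A : Set ℝ≥0, (a A : ℝ) ≤ ν A) {y : ℝ≥0}
    (hy : (ν (Metric.closedBall y δ) : ℝ) ≤ κ) :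
    |(a' (Iic y) : ℝ) - a (Iic y)| ≤ δ + κ := by
  have hball : ∀ A : Set ℝ≥0, A ⊆ Metric.closedBall y δ → (a A : ℝ) ≤ κ := fun A hA =>
    (NNReal.coe_le_coe.2 (a.apply_mono hA)).trans ((hν _).trans hy)
  have hmem : ∀ z : ℝ≥0, z ≤ y + δ → y ≤ z + δ → z ∈ Metric.closedBall y δ := by
    intro z h1 h2
    have h1' : (z : ℝ) ≤ y + δ := by exact_mod_cast h1
    have h2' : (y : ℝ) ≤ z + δ := by exact_mod_cast h2
    rw [Metric.mem_closedBall, NNReal.dist_eq, abs_le]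
    constructor <;> linarith
  have hup := NNReal.coe_le_coe.2 (h y).1
  push_cast at hup
  have h1 := hball (Iic (y + δ) \ Iic y) fun z hz =>
    hmem z hz.1 ((not_le.1 hz.2).le.trans le_self_add)
  rw [apply_sdiff a measurableSet_Iic (Iic_subset_Iic.2 le_self_add)] at h1
  rw [abs_le]
  refine ⟨?_, by linarith⟩
  by_cases hδ : δ ≤ y
  · have hlow := NNReal.coe_le_coe.2 (h (y - δ)).2
    rw [tsub_add_cancel_of_le hδ] at hlow
    push_cast at hlow
    have h2 := hball (Iic y \ Iic (y - δ)) fun z hz =>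
      hmem z (le_trans hz.1 le_self_add) (tsub_le_iff_right.1 (not_le.1 hz.2).le)
    rw [apply_sdiff a measurableSet_Iic (Iic_subset_Iic.2 tsub_le_self)] at h2
    linarith
  · have h2 := hball (Iic y) fun z hz =>
      hmem z (le_trans hz le_self_add) ((not_le.1 hδ).le.trans le_add_self)
    have h3 : (0 : ℝ) ≤ a' (Iic y) := NNReal.coe_nonneg _
    linarith [δ.coe_nonneg]

/-- A running maximum is 1-Lipschitz for the uniform distance, and `τ` maps `[0, t]` onto `[0, τ
t]`. -/
lemma abs_reg_sub_le {p p' : DMup × DRup} (τ : ℝ≥0 ≃o ℝ≥0) {A : Set ℝ≥0} {t : ℝ≥0} {c : ℝ}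
    (h : ∀ s ≤ t, |(p'.2.1 (τ s) - p'.1.1 (τ s) A) - (p.2.1 s - p.1.1 s A)| ≤ c) :
    |reg p' A (τ t) - reg p A t| ≤ c := by
  have hc : 0 ≤ c := (abs_nonneg _).trans (h t le_rfl)
  have h1 : reg p' A (τ t) ≤ reg p A t + c := by
    refine (reg_le_iff p').2 ⟨add_nonneg (reg_nonneg p) hc, fun s hs => ?_⟩
    have hs' : τ.symm s ≤ t := by rwa [OrderIso.symm_apply_le]
    have h2 := (abs_le.1 (h _ hs')).2
    rw [OrderIso.apply_symm_apply] at h2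
    linarith [le_reg p (A := A) hs']
  have h2 : reg p A t ≤ reg p' A (τ t) + c := by
    refine (reg_le_iff p).2 ⟨add_nonneg (reg_nonneg p') hc, fun s hs => ?_⟩
    linarith [(abs_le.1 (h s hs)).1, le_reg p' (A := A) (τ.monotone hs)]
  rw [abs_le]
  constructor <;> linarith

lemma LevyClose.abs_mass_sub_le {ν₁ ν₂ : M} {δ : ℝ≥0} (h : LevyClose ν₁ ν₂ δ) :
    |(ν₁.mass : ℝ) - ν₂.mass| ≤ δ := by
  have h1 : (ν₁.mass : ℝ) ≤ ν₂.mass + δ := by exact_mod_cast h.mass_le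
  have h2 : (ν₂.mass : ℝ) ≤ ν₁.mass + δ := by exact_mod_cast h.symm.mass_le
  rw [abs_le]
  constructor <;> linarith

/-- Convergence of distribution functions is needed only at finitely many grid points, chosen off
the atoms of `α_T`. As `α_t ≤ α_T` for `t ≤ T`, the same grid and the same `δ` serve all times up to
`T`, so the estimate survives the running maximum. -/
lemma exists_levyClose_solution (p : DMup × DRup) (T : ℝ≥0) {ε : ℝ≥0} (hε : 0 < ε) :
    ∃ δ : ℝ≥0, 0 < δ ∧ ∀ (p' : DMup × DRup) (s s' : D M × DMup × DRup) (τ : ℝ≥0 ≃o ℝ≥0),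
      IsSol p s → IsSol p' s' →
      (∀ t ≤ T, LevyClose (p'.1.1 (τ t)) (p.1.1 t) δ ∧ |p'.2.1 (τ t) - p.2.1 t| ≤ δ) →
      ∀ t ≤ T, LevyClose (s'.1 (τ t)) (s.1 t) ε ∧ LevyClose (s'.2.1.1 (τ t)) (s.2.1.1 t) ε ∧
        |s'.2.2.1 (τ t) - s.2.2.1 t| ≤ ε := by
  set ν := p.1.1 T with hν
  obtain ⟨e, he, rfl⟩ : ∃ e : ℝ≥0, 0 < e ∧ ε = 2 * e :=
    ⟨ε / 2, half_pos hε, (mul_div_cancel₀ ε two_ne_zero).symm⟩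
  have heR : (0 : ℝ) < e := he
  have hgrid : ∀ j : ℕ, ∃ y, j * e < y ∧ y < (j + 1) * e ∧ ν {y} = 0 := fun j =>
    exists_nonatom ν (by rw [add_mul, one_mul]; exact lt_add_of_pos_right _ he)
  choose y hy1 hy2 hy0 using hgrid
  obtain ⟨N, hN⟩ : ∃ N, (ν.mass : ℝ) ≤ ν (Iic (y N)) + e := by
    obtain ⟨x, hx⟩ := ((tendsto_Iic_atTop ν).eventually_const_lt
      (show (ν.mass : ℝ) - e < ν.mass by linarith)).exists
    obtain ⟨N, hN⟩ := exists_nat_ge (x / e)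
    have := monotone_Iic ν (((div_le_iff₀ he).1 hN).trans (hy1 N).le)
    simp only at this
    exact ⟨N, by linarith⟩
  obtain ⟨δ, hδ0, hδe, hδ⟩ : ∃ δ : ℝ≥0, 0 < δ ∧ (δ : ℝ) ≤ e / 8 ∧ ∀ j ≤ N + 1,
      (ν (Metric.closedBall (y j) δ) : ℝ) ≤ e / 8 := by
    -- The closed balls shrink to a point that is not an atom.
    have hball : ∀ j, ∀ᶠ r in 𝓝[>] (0 : ℝ), (ν (Metric.closedBall (y j) r) : ℝ) ≤ e / 8 := by
      intro j
      have h := tendsto_measure_cthickening_of_isClosed (μ := (ν : Measure ℝ≥0)) (s := {y j})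
        ⟨1, one_pos, measure_ne_top _ _⟩ isClosed_singleton
      have h' := ((ENNReal.tendsto_toReal (measure_ne_top _ _)).comp h).mono_left
        (nhdsWithin_le_nhds (s := Ioi 0))
      rw [(FiniteMeasure.null_iff_toMeasure_null ν {y j}).1 (hy0 j)] at h'
      filter_upwards [h'.eventually_le_const (show (0 : ℝ≥0∞).toReal < e / 8 by
        simp; positivity), self_mem_nhdsWithin] with r hr hr0
      simp only [Function.comp] at hr
      rwa [Metric.cthickening_singleton _ (le_of_lt hr0)] at hr
    have hall : ∀ᶠ r in 𝓝[>] (0 : ℝ), ∀ j ∈ Finset.range (N + 2),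
        (ν (Metric.closedBall (y j) r) : ℝ) ≤ e / 8 :=
      (Finset.eventually_all _).2 fun j _ => hball j
    have hsmall : ∀ᶠ r : ℝ in 𝓝[>] 0, r ≤ (e : ℝ) / 8 :=
      nhdsWithin_le_nhds (eventually_le_nhds (by positivity))
    obtain ⟨r, hr1, hr2, hr0⟩ := (hall.and (hsmall.and self_mem_nhdsWithin)).exists
    lift r to ℝ≥0 using le_of_lt hr0
    exact ⟨r, hr0, hr2, fun j hj => hr1 j (Finset.mem_range.2 (by omega))⟩
  -- Error budget: `e/8 + e/8` for `α` at grid points and `e/8` for `μ`, hence `3e/8` for the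
  -- regulator and at most `3e/4` for `ξ`.
  refine ⟨δ, hδ0, fun p' s s' τ hs hs' hp t ht => ?_⟩
  have hα : ∀ u ≤ T, ∀ j ≤ N + 1,
      |(p'.1.1 (τ u) (Iic (y j)) : ℝ) - p.1.1 u (Iic (y j))| ≤ e / 4 := by
    intro u hu j hj
    have := abs_Iic_sub_le (hp u hu).1 (fun A => monotone_apply p.1.2 A hu) (hδ j hj)
    linarith
  have hregj : ∀ j ≤ N + 1, |reg p' (Iic (y j)) (τ t) - reg p (Iic (y j)) t| ≤ 3 * e / 8 := by
    refine fun j hj => abs_reg_sub_le τ fun u hu => ?_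
    have h1 := abs_le.1 (hα u (hu.trans ht) j hj)
    have h2 := abs_le.1 (hp u (hu.trans ht)).2
    rw [abs_le]
    constructor <;> linarith
  have hregu : |reg p' univ (τ t) - reg p univ t| ≤ 3 * e / 8 := by
    refine abs_reg_sub_le τ fun u hu => ?_
    have h1 := abs_le.1 (hp u (hu.trans ht)).1.abs_mass_sub_le
    have h2 := abs_le.1 (hp u (hu.trans ht)).2
    change |(p'.2.1 (τ u) - ((p'.1.1 (τ u)).mass : ℝ)) - (p.2.1 u - (p.1.1 u).mass)| ≤ _
    rw [abs_le]
    constructor <;> linarith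
  have hregu' := abs_le.1 hregu
  have hμ := abs_le.1 (hp t ht).2
  have hm := abs_le.1 (hp t ht).1.abs_mass_sub_le
  have htail : ((p.1.1 t).mass : ℝ) ≤ p.1.1 t (Iic (y N)) + e := by
    have h1 := monotone_apply p.1.2 (Ioi (y N)) ht
    simp only at h1
    linarith [Iic_add_Ioi (p.1.1 t) (y N), Iic_add_Ioi (p.1.1 T) (y N)]
  -- These two bounds transfer the tail estimate for `α` to `β` and to `ξ`, respectively.
  have hr1 := reg_le_reg_univ_add p (t := t) (y N)
  have hr2 := reg_anti p (t := t) (subset_univ (Iic (y N)))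
  refine ⟨levyClose_of_grid (N := N) he (fun j => ⟨hy1 j, hy2 j⟩) (fun j hj => ?_) ?_ ?_,
    levyClose_of_grid (N := N) he (fun j => ⟨hy1 j, hy2 j⟩) (fun j hj => ?_) ?_ ?_, ?_⟩
  · rw [hs.queue, hs'.queue]
    have h1 := abs_le.1 (hα t ht j hj)
    have h2 := abs_le.1 (hregj j hj)
    rw [abs_le]
    constructor <;> linarith
  · rw [hs.queue_mass, hs'.queue_mass, abs_le]
    constructor <;> linarith
  · rw [hs.queue_mass, hs.queue]
    linarith
  · rw [hs.served, hs'.served]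
    have h2 := abs_le.1 (hregj j hj)
    rw [abs_le]
    constructor <;> linarith
  · rw [hs.mass, hs'.mass, abs_le]
    constructor <;> linarith
  · rw [hs.mass, hs.served]
    linarith
  · rw [hs.idle, hs'.idle, NNReal.coe_mul, NNReal.coe_two]
    linarith

/-! ### The Skorokhod topology -/

section topology

variable {S : Type*} [PseudoMetricSpace S]

lemma hasBasis_uniformity_D : (uniformity (D S)).HasBasis (fun q : ℝ≥0 × ℝ => 0 < q.2)
    fun q => j1Entourage S q.1 q.2 := by
  refine ⟨fun V => ?_⟩
  refine (FilterBasis.mem_filter_iff _).trans ?_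
  constructor
  · rintro ⟨_, ⟨T, ε, hε, rfl⟩, h⟩
    exact ⟨(T, ε), hε, h⟩
  · rintro ⟨q, hq, h⟩
    exact ⟨_, ⟨q.1, q.2, hq, rfl⟩, h⟩

lemma hasBasis_nhds_D (x : D S) : (𝓝 x).HasBasis (fun q : ℝ≥0 × ℝ => 0 < q.2)
    fun q => {y | (x, y) ∈ j1Entourage S q.1 q.2} :=
  nhds_basis_uniformity' hasBasis_uniformity_D

/-- This makes `D S` pseudometrizable, so that pointwise limits of Borel maps into it are Borel. -/
instance : (uniformity (D S)).IsCountablyGenerated := by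
  have h : (uniformity (D S)).HasBasis (fun _ : ℕ => True)
      fun n => j1Entourage S (n : ℝ≥0) (1 / ((n : ℝ) + 1)) := by
    refine hasBasis_uniformity_D.to_hasBasis (fun q hq => ?_) fun n _ =>
      ⟨((n : ℝ≥0), 1 / ((n : ℝ) + 1)), by positivity, subset_rfl⟩
    obtain ⟨n, hn⟩ := exists_nat_one_div_lt hq
    obtain ⟨m, hm⟩ := exists_nat_ge q.1
    refine ⟨max n m, trivial, j1Entourage_mono (hm.trans (by simp)) (le_trans ?_ hn.le)⟩
    gcongr
    exact le_max_left _ _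
  exact h.isCountablyGenerated

lemma tendsto_D_iff {ι : Type*} {L : Filter ι} {u : ι → D S} {x : D S} :
    Tendsto u L (𝓝 x) ↔ ∀ (T : ℝ≥0) (ε : ℝ), 0 < ε → ∀ᶠ i in L, (x, u i) ∈ j1Entourage S T ε :=
  (hasBasis_nhds_D x).tendsto_right_iff.trans ⟨fun h T ε hε => h (T, ε) hε, fun h _ hq => h _ _ hq⟩

lemma mem_j1Entourage_of_forall {x y : D S} {T : ℝ≥0} {ε : ℝ} (hε : 0 < ε)
    (h : ∀ t ≤ T, dist (y t) (x t) < ε) : (x, y) ∈ j1Entourage S T ε :=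
  ⟨OrderIso.refl _, fun t ht => ⟨by simpa using hε, h t ht⟩⟩

lemma symm_le_of_dist_lt {τ : ℝ≥0 ≃o ℝ≥0} {T t : ℝ≥0} (h : dist (τ (T + 1)) (T + 1) < 1)
    (ht : t ≤ T) : τ.symm t ≤ T + 1 := by
  rw [OrderIso.symm_apply_le]
  have h1 : (t : ℝ) ≤ T := ht
  rw [NNReal.dist_eq, abs_lt, NNReal.coe_add, NNReal.coe_one] at h
  rw [← NNReal.coe_le_coe]
  linarith [h.1]

/-- Near a continuous path, the Skorokhod topology controls the uniform distance. -/
lemma eventually_dist_lt_of_continuous {x : D S} (hx : Continuous x.toFun) (T : ℝ≥0) {ε : ℝ}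
    (hε : 0 < ε) : ∀ᶠ y in 𝓝 x, ∀ t ≤ T, dist (y t) (x t) < ε := by
  have huc := (isCompact_Icc (a := (0 : ℝ≥0)) (b := T + 1)).uniformContinuousOn_of_continuous
    hx.continuousOn
  obtain ⟨δ, hδ, h⟩ := Metric.uniformContinuousOn_iff.1 huc (ε / 2) (half_pos hε)
  have hmem := (hasBasis_nhds_D x).mem_of_mem (i := (T + 1, min (min δ 1) (ε / 2)))
    (show 0 < min (min δ 1) (ε / 2) by positivity)
  filter_upwards [hmem] with y ⟨τ, hτ⟩ t ht
  -- The time matched with `t` may exceed `T`; hence the margin of 1 in the entourage and in the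
  -- compact interval.
  have hs : τ.symm t ≤ T + 1 :=
    symm_le_of_dist_lt ((hτ _ le_rfl).1.trans_le ((min_le_left _ _).trans (min_le_right _ _))) ht
  obtain ⟨h1, h2⟩ := hτ _ hs
  rw [OrderIso.apply_symm_apply] at h1 h2
  have h3 := h (τ.symm t) ⟨zero_le, hs⟩ t ⟨zero_le, ht.trans le_self_add⟩ (by
    rw [dist_comm]
    exact h1.trans_le ((min_le_left _ _).trans (min_le_left _ _)))
  have h4 := h2.trans_le (min_le_right _ _)
  dsimp only at h4
  linarith [dist_triangle (y t) (x (τ.symm t)) (x t)]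

lemma continuous_ofContinuous : Continuous (ofContinuous : C(ℝ≥0, S) → D S) := by
  refine continuous_iff_continuousAt.2 fun x => tendsto_D_iff.2 fun T ε hε => ?_
  have h := ContinuousMap.tendsto_iff_forall_isCompact_tendstoUniformlyOn.1
    (tendsto_id (x := 𝓝 x)) (Icc 0 T) isCompact_Icc
  filter_upwards [Metric.tendstoUniformlyOn_iff.1 h ε hε] with y hy
  refine mem_j1Entourage_of_forall hε fun t ht => ?_
  rw [dist_comm]
  exact hy t ⟨zero_le, ht⟩

end topology

/-! ### Continuity of the Skorokhod map -/

/-- In the joint topology a single time change aligns `α` and `μ`; the same one aligns `ξ`, `β` and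
`ι`. -/
lemma tendsto_jointSol {ι : Type*} {L : Filter ι} {u : ι → DMup × DRup} {p : DMup × DRup}
    (h : Tendsto (fun i => jointData (u i)) L (𝓝 (jointData p))) :
    Tendsto (fun i => jointSol (skorokhodMap (u i))) L (𝓝 (jointSol (skorokhodMap p))) := by
  refine tendsto_D_iff.2 fun T ε hε => ?_
  lift ε to ℝ≥0 using hε.le
  have hε' : 0 < ε := by exact_mod_cast hε
  obtain ⟨δ, hδ, hsol⟩ := exists_levyClose_solution p T (half_pos hε')
  have hδε : 0 < min δ ε := lt_min hδ hε'
  filter_upwards [tendsto_D_iff.1 h T (min δ ε : ℝ≥0) (by exact_mod_cast hδε)] with i ⟨τ, hτ⟩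
  have hclose := hsol (u i) _ _ τ (isSol_skorokhodMap p) (isSol_skorokhodMap (u i)) fun t ht => by
    have h1 := (hτ t ht).2
    change max (dist ((u i).1.1 (τ t)) (p.1.1 t)) (dist ((u i).2.1 (τ t)) (p.2.1 t)) < _ at h1
    have hmin : ((min δ ε : ℝ≥0) : ℝ) ≤ δ := NNReal.coe_le_coe.2 (min_le_left _ _)
    exact ⟨levyClose_of_dist_lt ((le_max_left _ _).trans_lt (h1.trans_le hmin)),
      ((le_max_right _ _).trans_lt (h1.trans_le hmin)).le⟩
  have hhalf : ((ε / 2 : ℝ≥0) : ℝ) < ε := by exact_mod_cast half_lt_self hε'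
  refine ⟨τ, fun t ht => ⟨(hτ t ht).1.trans_le (NNReal.coe_le_coe.2 (min_le_right _ _)), ?_⟩⟩
  obtain ⟨h1, h2, h3⟩ := hclose t ht
  refine max_lt ((dist_le_of_levyClose (half_pos hε') h1).trans_lt hhalf) (max_lt
    ((dist_le_of_levyClose (half_pos hε') h2).trans_lt hhalf) (lt_of_le_of_lt h3 hhalf))

/-- Near continuous paths, `J₁` closeness is locally uniform closeness, so the two components need
no common time change. -/
lemma continuousAt_jointData {p : DMup × DRup} (h1 : Continuous p.1.1.toFun)
    (h2 : Continuous p.2.1.toFun) : ContinuousAt jointData p := by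
  refine tendsto_D_iff.2 fun T ε hε => ?_
  have c1 : Tendsto (fun p' : DMup × DRup => p'.1.1) (𝓝 p) (𝓝 p.1.1) :=
    (continuous_subtype_val.comp continuous_fst).continuousAt
  have c2 : Tendsto (fun p' : DMup × DRup => p'.2.1) (𝓝 p) (𝓝 p.2.1) :=
    (continuous_subtype_val.comp continuous_snd).continuousAt
  filter_upwards [c1.eventually (eventually_dist_lt_of_continuous h1 T hε),
    c2.eventually (eventually_dist_lt_of_continuous h2 T hε)] with p' hp1 hp2
  exact mem_j1Entourage_of_forall hε fun t ht => max_lt (hp1 t ht) (hp2 t ht)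

lemma continuousAt_jointSol_inclusion (q : CM0up × CRup) :
    ContinuousAt (fun p => jointSol (skorokhodMap p)) (inclusion q) :=
  tendsto_jointSol (continuousAt_jointData q.1.1.continuous q.2.1.continuous)

lemma continuous_inclusion : Continuous inclusion :=
  ((continuous_ofContinuous.comp (continuous_subtype_val.comp continuous_fst)).subtype_mk _).prodMk
    ((continuous_ofContinuous.comp (continuous_subtype_val.comp continuous_snd)).subtype_mk _)

lemma continuous_jointSol_inclusion :
    Continuous fun q : CM0up × CRup => jointSol (skorokhodMap (inclusion q)) :=
  continuous_iff_continuousAt.2 fun q =>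
    (continuousAt_jointSol_inclusion q).comp_of_eq continuous_inclusion.continuousAt rfl

/-! ### Approximation of paths by step functions -/

section step

variable {S : Type*}

lemma isCadlag_step [TopologicalSpace S] (n : ℕ) (v : ℕ → S) :
    IsCadlag fun t : ℝ≥0 => v ⌊((n : ℝ≥0) + 1) * t⌋₊ := by
  have hN : (0 : ℝ≥0) < (n : ℝ≥0) + 1 := by positivity
  refine ⟨fun t => ?_, fun t ht => ?_⟩
  · have hlt : t < ((⌊((n : ℝ≥0) + 1) * t⌋₊ : ℝ≥0) + 1) / ((n : ℝ≥0) + 1) := by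
      rw [lt_div_iff₀ hN, mul_comm]
      exact Nat.lt_floor_add_one _
    refine tendsto_const_nhds.congr' ?_
    filter_upwards [Ico_mem_nhdsGE hlt] with s hs
    congr 1
    refine ((Nat.floor_eq_iff zero_le).2 ⟨(Nat.floor_le zero_le).trans ?_, ?_⟩).symm
    · gcongr
      exact hs.1
    · rw [mul_comm, ← lt_div_iff₀ hN]
      exact hs.2
  -- The left limit at `t` is `v (⌈(n + 1) t⌉ - 1)`, whether or not `t` is a grid point.
  · have hpos : 0 < ⌈((n : ℝ≥0) + 1) * t⌉₊ := Nat.ceil_pos.2 (by positivity)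
    obtain ⟨m, hm⟩ := Nat.exists_eq_succ_of_ne_zero hpos.ne'
    have hm1 : (m : ℝ≥0) < ((n : ℝ≥0) + 1) * t := Nat.lt_ceil.1 (by omega)
    have hm2 : ((n : ℝ≥0) + 1) * t ≤ m + 1 := by
      have := Nat.le_ceil (((n : ℝ≥0) + 1) * t)
      rw [hm] at this
      exact_mod_cast this
    have hlt : (m : ℝ≥0) / ((n : ℝ≥0) + 1) < t := by
      rwa [div_lt_iff₀ hN, mul_comm]
    refine ⟨v m, tendsto_const_nhds.congr' ?_⟩
    filter_upwards [Ico_mem_nhdsLT hlt] with s hs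
    congr 1
    refine ((Nat.floor_eq_iff zero_le).2 ⟨?_, lt_of_lt_of_le ?_ hm2⟩).symm
    · rw [mul_comm, ← div_le_iff₀ hN]
      exact hs.1
    · gcongr
      exact hs.2

/-- The step path with value `v k` on `[k / (n + 1), (k + 1) / (n + 1))`. -/
noncomputable def step [TopologicalSpace S] (n : ℕ) (v : ℕ → S) : D S := ⟨_, isCadlag_step n v⟩

variable [PseudoMetricSpace S]

lemma continuous_step (n : ℕ) : Continuous (step n : (ℕ → S) → D S) := by
  refine continuous_iff_continuousAt.2 fun v => tendsto_D_iff.2 fun T ε hε => ?_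
  have h : ∀ᶠ w in 𝓝 v, ∀ k ∈ Finset.range (⌊((n : ℝ≥0) + 1) * T⌋₊ + 1), dist (w k) (v k) < ε :=
    (Finset.eventually_all _).2 fun k _ =>
      Metric.tendsto_nhds.1 (continuous_apply k).continuousAt.tendsto ε hε
  filter_upwards [h] with w hw
  refine mem_j1Entourage_of_forall hε fun t ht => hw _ ?_
  rw [Finset.mem_range, Nat.lt_succ_iff]
  gcongr

/-- An increasing bijection of `[0, ∞)` can be continued after any time by an affine function. -/
lemma exists_extend_orderIso (τ : ℝ≥0 ≃o ℝ≥0) (v : ℝ≥0) {c : ℝ≥0} (hc : 0 < c) :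
    ∃ τ' : ℝ≥0 ≃o ℝ≥0, (∀ s ≤ v, τ' s = τ s) ∧ ∀ s, v ≤ s → τ' s = τ v + (s - v) * c := by
  let f : ℝ≥0 → ℝ≥0 := fun s => τ (min s v) + (s - v) * c
  have h1 : ∀ s ≤ v, f s = τ s := fun s hs => by
    simp [f, hs, tsub_eq_zero_of_le hs]
  have h2 : ∀ s, v ≤ s → f s = τ v + (s - v) * c := fun s hs => by simp [f, hs]
  have hm : StrictMono f := by
    intro s s' hs
    rcases le_or_gt s' v with h | h
    · rw [h1 s' h, h1 s (hs.le.trans h)]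
      exact τ.strictMono hs
    · refine add_lt_add_of_le_of_lt (τ.monotone (min_le_min_right _ hs.le)) ?_
      have : s - v < s' - v := by
        rcases le_total s v with h' | h'
        · rw [tsub_eq_zero_of_le h']
          exact tsub_pos_of_lt h
        · exact tsub_lt_tsub_right_of_le h' hs
      gcongr
  have hs : Function.Surjective f := by
    intro y
    rcases le_total y (τ v) with h | h
    · refine ⟨τ.symm y, ?_⟩
      rw [h1 _ (by rwa [OrderIso.symm_apply_le]), OrderIso.apply_symm_apply]
    · refine ⟨v + (y - τ v) / c, ?_⟩
      rw [h2 _ le_self_add, add_tsub_cancel_left, div_mul_cancel₀ _ hc.ne',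
        add_tsub_cancel_of_le h]
  exact ⟨hm.orderIsoOfSurjective f hs, h1, h2⟩

/-- Eventually, the approximation of `x` by its step functions is `ε`-good before time `t`, and
the time change maps `t` to a grid point. -/
def StepGood (x : D S) (ε : ℝ) (t : ℝ≥0) : Prop :=
  ∀ᶠ n : ℕ in atTop, ∃ τ : ℝ≥0 ≃o ℝ≥0,
    τ t = (⌈((n : ℝ≥0) + 1) * t⌉₊ : ℝ≥0) / ((n : ℝ≥0) + 1) ∧
    ∀ s < t, dist (τ s) s ≤ 1 / ((n : ℝ) + 1) ∧
      dist (x ((⌊((n : ℝ≥0) + 1) * τ s⌋₊ : ℝ≥0) / ((n : ℝ≥0) + 1))) (x s) < ε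

/-- The time change is continued affinely so as to send `[v, t]` onto the interval between the grid
points just above `v` and `t`. On it the step path samples `x` only at grid points in `[v, t)`,
where `x` oscillates by less than `ε`. -/
lemma StepGood.extend {x : D S} {ε : ℝ} {v t : ℝ≥0} (h : StepGood x ε v) (hvt : v < t)
    (hosc : ∀ r ∈ Ico v t, ∀ s ∈ Ico v t, dist (x r) (x s) < ε) : StepGood x ε t := by
  -- A mesh smaller than `t - v` puts `v` and `t` under different grid points, so the affine piece
  -- has positive slope.
  have hlarge : ∀ᶠ n : ℕ in atTop, 1 / ((n : ℝ) + 1) < t - v :=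
    (tendsto_one_div_add_atTop_nhds_zero_nat (𝕜 := ℝ)).eventually_lt_const
      (sub_pos.2 (NNReal.coe_lt_coe.2 hvt))
  filter_upwards [h, hlarge] with n ⟨τ, hτv, hτ⟩ hn
  have hN : (0 : ℝ≥0) < (n : ℝ≥0) + 1 := by positivity
  have hNR : (0 : ℝ) < (n : ℝ) + 1 := by positivity
  have hgrid : ∀ r : ℝ≥0,
      (r : ℝ) ≤ ((⌈((n : ℝ≥0) + 1) * r⌉₊ : ℝ≥0) / ((n : ℝ≥0) + 1) : ℝ≥0) ∧
      (((⌈((n : ℝ≥0) + 1) * r⌉₊ : ℝ≥0) / ((n : ℝ≥0) + 1) : ℝ≥0) : ℝ) ≤ r + 1 / ((n : ℝ) + 1) := by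
    intro r
    have a1 := Nat.le_ceil (((n : ℝ≥0) + 1) * r)
    have a2 := (Nat.ceil_lt_add_one (a := ((n : ℝ≥0) + 1) * r) zero_le).le
    constructor
    · rw [NNReal.coe_le_coe, le_div_iff₀ hN, mul_comm]
      exact a1
    · have : (⌈((n : ℝ≥0) + 1) * r⌉₊ : ℝ≥0) / ((n : ℝ≥0) + 1) ≤ r + 1 / ((n : ℝ≥0) + 1) := by
        rw [div_le_iff₀ hN]
        refine a2.trans_eq ?_
        field_simp
      exact_mod_cast this
  set b : ℝ≥0 := (⌈((n : ℝ≥0) + 1) * t⌉₊ : ℝ≥0) / ((n : ℝ≥0) + 1) with hb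
  obtain ⟨hv1, hv2⟩ := hgrid v
  obtain ⟨ht1, ht2⟩ := hgrid t
  rw [← hτv] at hv1 hv2
  rw [← hb] at ht1 ht2
  have hlt : τ v < b := by
    rw [← NNReal.coe_lt_coe]
    linarith
  have hd : 0 < t - v := tsub_pos_of_lt hvt
  obtain ⟨τ', h1, h2⟩ := exists_extend_orderIso τ v (div_pos (tsub_pos_of_lt hlt) hd)
  have hτt : τ' t = b := by
    rw [h2 t hvt.le, mul_div_cancel₀ _ hd.ne', add_tsub_cancel_of_le hlt.le]
  refine ⟨τ', hτt, fun s hs => ?_⟩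
  rcases lt_or_ge s v with hsv | hsv
  · rw [h1 s hsv.le]
    exact hτ s hsv
  · constructor
    · have h3 : (τ' s : ℝ) = τ v + (s - v) * ((b - τ v) / (t - v)) := by
        rw [h2 s hsv, NNReal.coe_add, NNReal.coe_mul, NNReal.coe_div, NNReal.coe_sub hsv,
          NNReal.coe_sub hlt.le, NNReal.coe_sub hvt.le]
      have hdR : (0 : ℝ) < t - v := sub_pos.2 (NNReal.coe_lt_coe.2 hvt)
      set l : ℝ := (s - v) / (t - v) with hl
      have hl0 : 0 ≤ l := div_nonneg (sub_nonneg.2 (NNReal.coe_le_coe.2 hsv)) hdR.le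
      have hl1 : l ≤ 1 := by
        rw [hl, div_le_one hdR]
        linarith [NNReal.coe_lt_coe.2 hs]
      have hs' : (s : ℝ) - v = l * (t - v) := by rw [hl, div_mul_cancel₀ _ hdR.ne']
      -- The displacement at `s` is a convex combination of those at `v` and `t`, both in `[0, 1 /
      -- (n + 1)]`.
      have h4 : (τ' s : ℝ) - s = (1 - l) * (τ v - v) + l * (b - t) := by
        have h5 : (τ' s : ℝ) = τ v + l * (b - τ v) := by
          rw [h3, hl]
          ring
        rw [h5]
        linear_combination (-1 : ℝ) * hs'
      rw [NNReal.dist_eq, h4, abs_of_nonneg (by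
        have := mul_nonneg (sub_nonneg.2 hl1) (sub_nonneg.2 hv1)
        have := mul_nonneg hl0 (sub_nonneg.2 ht1)
        linarith)]
      have e1 := mul_le_mul_of_nonneg_left (sub_le_iff_le_add'.2 hv2) (sub_nonneg.2 hl1)
      have e2 := mul_le_mul_of_nonneg_left (sub_le_iff_le_add'.2 ht2) hl0
      linarith
    · refine hosc _ ⟨?_, ?_⟩ s ⟨hsv, hs⟩
      · have h3 : τ v ≤ τ' s := by rw [h2 s hsv]; exact le_self_add
        have h4 : ⌈((n : ℝ≥0) + 1) * v⌉₊ ≤ ⌊((n : ℝ≥0) + 1) * τ' s⌋₊ := by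
          rw [Nat.le_floor_iff zero_le, ← div_le_iff₀' hN, ← hτv]
          exact h3
        refine (show v ≤ τ v from NNReal.coe_le_coe.1 hv1).trans ?_
        rw [hτv]
        gcongr
      · have h3 : τ' s < b := by rw [← hτt]; exact τ'.strictMono hs
        have h4 : ⌊((n : ℝ≥0) + 1) * τ' s⌋₊ < ⌈((n : ℝ≥0) + 1) * t⌉₊ := by
          rw [Nat.floor_lt zero_le, ← lt_div_iff₀' hN]
          exact h3
        rw [div_lt_iff₀' hN]
        exact Nat.lt_ceil.1 h4

/-- A supremum argument: the left limit of `x` at the supremum of the good times makes it good, and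
right continuity would carry goodness past it if it were below `T`. -/
lemma stepGood (x : D S) {ε : ℝ} (hε : 0 < ε) (T : ℝ≥0) : StepGood x ε T := by
  have h0 : StepGood x ε 0 := Eventually.of_forall fun n =>
    ⟨OrderIso.refl _, by simp, fun s hs => absurd hs not_lt_zero⟩
  have osc : ∀ {s : Set ℝ≥0} {l : S}, (∀ r ∈ s, dist (x r) l < ε / 2) →
      ∀ r ∈ s, ∀ r' ∈ s, dist (x r) (x r') < ε := fun {_ l} h r hr r' hr' => by
    have h1 := h r hr
    have h2 := h r' hr'
    exact (dist_triangle_right _ _ l).trans_lt (by linarith)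
  set A := {t | t ≤ T ∧ StepGood x ε t} with hA
  have hne : A.Nonempty := ⟨0, zero_le, h0⟩
  have hbdd : BddAbove A := ⟨T, fun t ht => ht.1⟩
  have hσT : sSup A ≤ T := csSup_le hne fun t ht => ht.1
  have hσ : StepGood x ε (sSup A) := by
    rcases eq_or_ne (sSup A) 0 with h | h
    · rwa [h]
    have hpos : 0 < sSup A := pos_iff_ne_zero.2 h
    obtain ⟨l, hl⟩ := x.cadlag.2 _ hpos
    obtain ⟨u, hu, hul⟩ := (mem_nhdsLT_iff_exists_Ioo_subset' hpos).1
      (Metric.tendsto_nhds.1 hl (ε / 2) (half_pos hε))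
    obtain ⟨v, hv, huv⟩ := exists_lt_of_lt_csSup hne hu
    rcases (le_csSup hbdd hv).eq_or_lt with h | h
    · exact h ▸ hv.2
    · exact hv.2.extend h (osc fun r hr => hul ⟨huv.trans_le hr.1, hr.2⟩)
  rcases hσT.eq_or_lt with h | h
  · rwa [h] at hσ
  obtain ⟨u, hu, hul⟩ := (mem_nhdsGE_iff_exists_Ico_subset' h).1
    (Metric.tendsto_nhds.1 (x.cadlag.1 (sSup A)).tendsto (ε / 2) (half_pos hε))
  have hlt : sSup A < min u T := lt_min hu h
  have hmem : min u T ∈ A := ⟨min_le_right _ _, hσ.extend hlt (osc fun r hr =>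
    hul ⟨hr.1, hr.2.trans_le (min_le_left _ _)⟩)⟩
  exact absurd (le_csSup hbdd hmem) (not_le.2 hlt)

lemma tendsto_step (x : D S) :
    Tendsto (fun n : ℕ => step n fun k => x ((k : ℝ≥0) / ((n : ℝ≥0) + 1))) atTop (𝓝 x) := by
  refine tendsto_D_iff.2 fun T ε hε => ?_
  -- `StepGood` controls only times strictly before its argument, and `t = T` is needed.
  filter_upwards [stepGood x hε (T + 1),
    (tendsto_one_div_add_atTop_nhds_zero_nat (𝕜 := ℝ)).eventually_lt_const hε] with n hn' hn
  obtain ⟨τ, -, hτ⟩ := hn'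
  refine ⟨τ, fun t ht => ?_⟩
  obtain ⟨h1, h2⟩ := hτ t (ht.trans_lt (lt_add_of_pos_right _ one_pos))
  exact ⟨h1.trans_lt hn, h2⟩

end step

/-! ### Time averages -/

/-- The average of `a` over `[t, t + h]`. -/
noncomputable def avg (a : ℝ≥0 → ℝ) (h t : ℝ≥0) : ℝ := ∫ u in (0 : ℝ)..1, a (t + h * u.toNNReal)

section avg

variable {a b : ℝ≥0 → ℝ} {h t δ : ℝ≥0} {c : ℝ}

lemma monotone_comp_toNNReal (ha : Monotone a) :
    Monotone fun u : ℝ => a (t + h * u.toNNReal) := fun u v huv =>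
  ha (by gcongr)

lemma avg_le_avg_add (ha : Monotone a) (hb : Monotone b)
    (hab : ∀ s, t ≤ s → s ≤ t + h → b s ≤ a s + c) :
    avg b h t ≤ avg a h t + c := by
  have h1 : ∫ u in (0 : ℝ)..1, (a (t + h * u.toNNReal) + c) = avg a h t + c := by
    rw [intervalIntegral.integral_add (monotone_comp_toNNReal ha).intervalIntegrable
      intervalIntegrable_const]
    simp [avg]
  rw [← h1]
  refine intervalIntegral.integral_mono_on zero_le_one
    (monotone_comp_toNNReal hb).intervalIntegrable
    ((monotone_comp_toNNReal ha).intervalIntegrable.add intervalIntegrable_const) fun u hu =>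
      hab _ le_self_add ?_
  gcongr
  exact mul_le_of_le_one_right zero_le (Real.toNNReal_le_one.2 hu.2)

lemma avg_const : avg (fun _ => c) h t = c := by simp [avg]

lemma le_avg (ha : Monotone a) : a t ≤ avg a h t := by
  have := avg_le_avg_add (c := 0) (h := h) (t := t) ha (monotone_const (c := a t))
    fun s hs _ => by simpa using ha hs
  simpa [avg_const] using this

lemma avg_le (ha : Monotone a) : avg a h t ≤ a (t + h) := by
  have := avg_le_avg_add (c := 0) (h := h) (t := t) (monotone_const (c := a (t + h))) ha
    fun s _ hs => by simpa using ha hs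
  simpa [avg_const] using this

/-- Shifting the window by `δ` drops a non-negative piece and adds a piece of relative length `δ /
h` on which `a` is at most `a (t + h + δ)`. -/
lemma avg_shift_le (ha : Monotone a) (h0 : ∀ s, 0 ≤ a s) (hh : 0 < h) :
    avg (fun s => a (s + δ)) h t ≤ avg a h t + δ / h * a (t + h + δ) := by
  set φ : ℝ → ℝ := fun u => a (t + h * u.toNNReal) with hφ
  have hφm : Monotone φ := monotone_comp_toNNReal ha
  have hint : ∀ u v, IntervalIntegrable φ volume u v := fun u v => hφm.intervalIntegrable
  set d : ℝ := δ / h with hd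
  have hd0 : 0 ≤ d := by positivity
  have h1 : avg (fun s => a (s + δ)) h t = ∫ u in (0 : ℝ)..1, φ (u + d) := by
    refine intervalIntegral.integral_congr fun u hu => ?_
    rw [uIcc_of_le zero_le_one] at hu
    simp only [hφ]
    have hdn : d.toNNReal = δ / h := by
      rw [hd, ← NNReal.coe_div, Real.toNNReal_coe]
    rw [Real.toNNReal_add hu.1 hd0, hdn, mul_add, mul_div_cancel₀ _ hh.ne', add_assoc]
  have h2 : φ (1 + d) = a (t + h + δ) := by
    simp only [hφ]
    have hdn : d.toNNReal = δ / h := by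
      rw [hd, ← NNReal.coe_div, Real.toNNReal_coe]
    rw [Real.toNNReal_add zero_le_one hd0, hdn, mul_add, mul_div_cancel₀ _ hh.ne', add_assoc]
    simp
  have h3 : ∫ u in (1 : ℝ)..(1 + d), φ u ≤ d * φ (1 + d) := by
    have := intervalIntegral.integral_mono_on (a := 1) (b := 1 + d) (by linarith) (hint _ _)
      (intervalIntegrable_const (c := φ (1 + d))) fun u hu => hφm hu.2
    simpa using this
  have h4 : 0 ≤ ∫ u in (0 : ℝ)..d, φ u :=
    intervalIntegral.integral_nonneg hd0 fun u _ => h0 _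
  have h5 := intervalIntegral.integral_add_adjacent_intervals (hint 0 d) (hint d (1 + d))
  have h6 := intervalIntegral.integral_add_adjacent_intervals (hint 0 1) (hint 1 (1 + d))
  rw [h1, intervalIntegral.integral_comp_add_right, zero_add, ← h2]
  have h7 : avg a h t = ∫ u in (0 : ℝ)..1, φ u := rfl
  linarith

lemma avg_le_of_le_shift (ha : Monotone a) (h0 : ∀ s, 0 ≤ a s) (hb : Monotone b) (hh : 0 < h)
    (hab : ∀ s ≤ t + h, b s ≤ a (s + δ) + δ) {C : ℝ} (hC : a (t + h + δ) ≤ C) :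
    avg b h t ≤ avg a h t + δ * (C / h + 1) := by
  have h1 := avg_le_avg_add (t := t) (h := h) (c := δ) (a := fun s => a (s + δ))
    (fun s s' hs => ha (by gcongr)) hb fun s _ hs => hab s hs
  have h2 := avg_shift_le (t := t) (δ := δ) ha h0 hh
  have h3 : (δ : ℝ) / h * a (t + h + δ) ≤ δ / h * C := by gcongr
  have h4 : (δ : ℝ) * (C / h + 1) = δ / h * C + δ := by ring
  linarith

lemma tendsto_avg (ha : Monotone a) (hc : ContinuousWithinAt a (Ici t) t) :
    Tendsto (fun j : ℕ => avg a (1 / ((j : ℝ≥0) + 1)) t) atTop (𝓝 (a t)) := by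
  refine tendsto_of_tendsto_of_tendsto_of_le_of_le tendsto_const_nhds ?_
    (fun j => le_avg ha) (fun j => avg_le ha)
  refine hc.tendsto.comp (tendsto_nhdsWithin_iff.2 ⟨?_,
    Eventually.of_forall fun _ => mem_Ici.2 le_self_add⟩)
  have : Tendsto (fun j : ℕ => 1 / ((j : ℝ≥0) + 1)) atTop (𝓝 0) := by
    rw [← NNReal.tendsto_coe]
    simpa using tendsto_one_div_add_atTop_nhds_zero_nat (𝕜 := ℝ)
  simpa using this.const_add t

end avg

lemma exists_avgM (α : DMup) (h t : ℝ≥0) :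
    ∃ ν : M, ∀ x, (ν (Iic x) : ℝ) = avg (fun s => (α.1 s (Iic x) : ℝ)) h t := by
  have hα := fun x => monotone_apply α.2 (Iic x)
  have hm : ∀ x y, x ≤ y → avg (fun s => (α.1 s (Iic x) : ℝ)) h t ≤
      avg (fun s => (α.1 s (Iic y) : ℝ)) h t := fun x y hxy => by
    simpa using avg_le_avg_add (c := 0) (h := h) (t := t) (hα y) (hα x) fun s _ _ => by
      simpa using monotone_Iic (α.1 s) hxy
  refine exists_measure (fun x => (NNReal.coe_nonneg _).trans (le_avg (hα x))) hm (fun x => ?_)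
    (C := (α.1 (t + h)).mass) fun x => (avg_le (hα x)).trans (Iic_le_mass _ _)
  have hlim := ((tendsto_Iic_nhdsGE (α.1 (t + h)) x).sub_const
    (α.1 (t + h) (Iic x) : ℝ)).const_add (avg (fun s => (α.1 s (Iic x) : ℝ)) h t)
  simp only [sub_self, add_zero] at hlim
  refine tendsto_of_tendsto_of_tendsto_of_le_of_le' tendsto_const_nhds hlim ?_ ?_
  · filter_upwards [self_mem_nhdsWithin] with y hy
    exact hm x y hy
  · filter_upwards [self_mem_nhdsWithin] with y hy
    refine avg_le_avg_add (hα x) (hα y) fun s _ hs => ?_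
    have h1 := monotone_apply α.2 (Iic y \ Iic x) hs
    simp only [apply_sdiff _ measurableSet_Iic (Iic_subset_Iic.2 (mem_Ici.1 hy))] at h1
    linarith

/-- The average of a path of finite measures over `[t, t + h]`. -/
noncomputable def avgM (α : DMup) (h t : ℝ≥0) : M := (exists_avgM α h t).choose

lemma avgM_Iic (α : DMup) (h t x : ℝ≥0) :
    (avgM α h t (Iic x) : ℝ) = avg (fun s => (α.1 s (Iic x) : ℝ)) h t :=
  (exists_avgM α h t).choose_spec x

/-- The increments of `α[0, x]` are at most those of the total mass, so the error is bounded
uniformly in `x` by that of the averaged mass. -/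
lemma tendsto_avgM (α : DMup) (t : ℝ≥0) :
    Tendsto (fun j : ℕ => avgM α (1 / ((j : ℝ≥0) + 1)) t) atTop (𝓝 (α.1 t)) := by
  have hlim := tendsto_avg (monotone_mass α) ((isCadlag_mass α).1 t)
  have hlim' := hlim.sub_const ((α.1 t).mass : ℝ)
  rw [sub_self] at hlim'
  refine tendsto_M_of_abs_le hlim' (Eventually.of_forall fun j x => ?_)
  have h1 := le_avg (h := 1 / ((j : ℝ≥0) + 1)) (t := t) (monotone_apply α.2 (Iic x))
  have h2 := avg_le_avg_add (h := 1 / ((j : ℝ≥0) + 1)) (t := t)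
    (c := (α.1 t (Iic x) : ℝ) - (α.1 t).mass) (monotone_mass α) (monotone_apply α.2 (Iic x))
    fun s hs _ => by linarith [apply_sub_apply_le α hs (measurableSet_Iic (a := x))]
  rw [avgM_Iic, abs_of_nonneg (sub_nonneg.2 h1)]
  linarith

lemma dist_of_mem_j1Entourage {S : Type*} [PseudoMetricSpace S] {x y : D S} {T δ s : ℝ≥0}
    (h : (x, y) ∈ j1Entourage S (T + 1) δ) (hδ : δ ≤ 1) (hs : s ≤ T) :
    (∃ r ≤ s + δ, dist (y s) (x r) < δ) ∧ ∃ r ≤ s + δ, dist (y r) (x s) < δ := by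
  obtain ⟨τ, hτ⟩ := h
  have hδ' : (δ : ℝ) ≤ 1 := hδ
  constructor
  · obtain ⟨h1, h2⟩ := hτ _ (symm_le_of_dist_lt ((hτ _ le_rfl).1.trans_le hδ') hs)
    rw [OrderIso.apply_symm_apply] at h1 h2
    rw [NNReal.dist_eq, abs_lt] at h1
    refine ⟨_, ?_, h2⟩
    rw [← NNReal.coe_le_coe, NNReal.coe_add]
    linarith [h1.1]
  · obtain ⟨h1, h2⟩ := hτ s (hs.trans le_self_add)
    rw [NNReal.dist_eq, abs_lt] at h1
    refine ⟨_, ?_, h2⟩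
    rw [← NNReal.coe_le_coe, NNReal.coe_add]
    linarith [h1.2]

lemma exists_small {ε : ℝ≥0} (hε : 0 < ε) (K : ℝ≥0) :
    ∃ δ : ℝ≥0, 0 < δ ∧ δ ≤ 1 ∧ δ * (K + 1) ≤ ε := by
  refine ⟨min 1 (ε / (K + 1)), lt_min one_pos (by positivity), min_le_left _ _, ?_⟩
  rw [← le_div_iff₀ (by positivity)]
  exact min_le_right _ _

/-- Evaluation at a jump time is not `J₁` continuous, but for monotone paths `J₁` closeness gives
`g' s ≤ g (s + δ) + δ` and the converse bound; averaging turns the time shift into an error of order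
`δ / h`. -/
lemma continuous_avg {h : ℝ≥0} (hh : 0 < h) (t : ℝ≥0) : Continuous fun g : DRup => avg g.1 h t := by
  refine continuous_iff_continuousAt.2 fun g => Metric.tendsto_nhds.2 fun ε hε => ?_
  lift ε to ℝ≥0 using hε.le
  have hε' : 0 < ε := by exact_mod_cast hε
  -- Since `δ ≤ 1`, this bounds both paths at `t + h + δ`; for `g'` one further shift by `δ` and an
  -- error `δ` are used.
  set C : ℝ≥0 := (g.1 (t + h + 2)).toNNReal + 1 with hC
  have hCg : g.1 (t + h + 2) + 1 = C := by
    rw [hC, NNReal.coe_add, Real.coe_toNNReal _ (g.2.1 _), NNReal.coe_one]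
  obtain ⟨δ, hδ0, hδ1, hδ⟩ := exists_small (half_pos hε') (C / h)
  have hδ1' : (δ : ℝ) ≤ 1 := hδ1
  have hδ' : (δ : ℝ) * (C / h + 1) ≤ ε / 2 := by exact_mod_cast hδ
  have hmem : ∀ᶠ g' : DRup in 𝓝 g, (g.1, g'.1) ∈ j1Entourage ℝ (t + h + 1 + 1) δ :=
    tendsto_D_iff.1 continuous_subtype_val.continuousAt _ _ (by exact_mod_cast hδ0)
  filter_upwards [hmem] with g' hg'
  have up : ∀ s ≤ t + h + 1, g'.1 s ≤ g.1 (s + δ) + δ := fun s hs => by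
    obtain ⟨⟨r, hr, h1⟩, -⟩ := dist_of_mem_j1Entourage hg' hδ1 hs
    rw [Real.dist_eq, abs_lt] at h1
    linarith [g.2.2 hr]
  have low : ∀ s ≤ t + h + 1, g.1 s ≤ g'.1 (s + δ) + δ := fun s hs => by
    obtain ⟨-, r, hr, h1⟩ := dist_of_mem_j1Entourage hg' hδ1 hs
    rw [Real.dist_eq, abs_lt] at h1
    linarith [g'.2.2 hr]
  have b1 : g.1 (t + h + δ) ≤ C := by
    have : t + h + δ ≤ t + h + 2 := by gcongr; exact hδ1.trans one_le_two
    linarith [g.2.2 this]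
  have b2 : g'.1 (t + h + δ) ≤ C := by
    have h2 : t + h + δ + δ ≤ t + h + 2 := by
      rw [add_assoc (t + h), ← one_add_one_eq_two]
      gcongr
    linarith [up (t + h + δ) (by gcongr), g.2.2 h2]
  have c1 := avg_le_of_le_shift g.2.2 g.2.1 g'.2.2 hh (fun s hs => up s (hs.trans le_self_add)) b1
  have c2 := avg_le_of_le_shift g'.2.2 g'.2.1 g.2.2 hh (fun s hs => low s (hs.trans le_self_add)) b2
  rw [Real.dist_eq, abs_lt]
  constructor <;> linarith

lemma continuous_avgM {h : ℝ≥0} (hh : 0 < h) (t : ℝ≥0) :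
    Continuous fun α : DMup => avgM α h t := by
  refine continuous_iff_continuousAt.2 fun α => Metric.tendsto_nhds.2 fun ε hε => ?_
  lift ε to ℝ≥0 using hε.le
  have hε' : 0 < ε := by exact_mod_cast hε
  set C : ℝ≥0 := (α.1 (t + h + 2)).mass + 1 with hC
  have hCα : ((α.1 (t + h + 2)).mass : ℝ) + 1 = C := by rw [hC, NNReal.coe_add, NNReal.coe_one]
  obtain ⟨δ, hδ0, hδ1, hδ⟩ := exists_small (half_pos hε') (C / h)
  have hδ1' : (δ : ℝ) ≤ 1 := hδ1
  have hmem : ∀ᶠ α' : DMup in 𝓝 α, (α.1, α'.1) ∈ j1Entourage M (t + h + 1 + 1) δ :=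
    tendsto_D_iff.1 continuous_subtype_val.continuousAt _ _ (by exact_mod_cast hδ0)
  filter_upwards [hmem] with α' hα'
  have up : ∀ s ≤ t + h + 1, ∀ x, (α'.1 s (Iic x) : ℝ) ≤ α.1 (s + δ) (Iic (x + δ)) + δ :=
    fun s hs x => by
      obtain ⟨⟨r, hr, h1⟩, -⟩ := dist_of_mem_j1Entourage hα' hδ1 hs
      have h2 := NNReal.coe_le_coe.2 (levyClose_of_dist_lt h1 x).1
      have h3 := monotone_apply α.2 (Iic (x + δ)) hr
      simp only [NNReal.coe_add] at h2 h3
      linarith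
  have low : ∀ s ≤ t + h + 1, ∀ x, (α.1 s (Iic x) : ℝ) ≤ α'.1 (s + δ) (Iic (x + δ)) + δ :=
    fun s hs x => by
      obtain ⟨-, r, hr, h1⟩ := dist_of_mem_j1Entourage hα' hδ1 hs
      have h2 := NNReal.coe_le_coe.2 (levyClose_of_dist_lt h1 x).2
      have h3 := monotone_apply α'.2 (Iic (x + δ)) hr
      simp only [NNReal.coe_add] at h2 h3
      linarith
  have b1 : ∀ x, (α.1 (t + h + δ) (Iic x) : ℝ) ≤ C := fun x => by
    have : t + h + δ ≤ t + h + 2 := by gcongr; exact hδ1.trans one_le_two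
    have h1 := monotone_mass α this
    simp only at h1
    linarith [Iic_le_mass (α.1 (t + h + δ)) x]
  have b2 : ∀ x, (α'.1 (t + h + δ) (Iic x) : ℝ) ≤ C := fun x => by
    have h2 : t + h + δ + δ ≤ t + h + 2 := by
      rw [add_assoc (t + h), ← one_add_one_eq_two]
      gcongr
    have h1 := monotone_mass α h2
    simp only at h1
    linarith [up (t + h + δ) (by gcongr) x, Iic_le_mass (α.1 (t + h + δ + δ)) (x + δ)]
  have hclose : LevyClose (avgM α' h t) (avgM α h t) (δ * (C / h + 1)) := by
    intro x
    -- The Lévy metric also shifts space by `δ`; the averaging error already exceeds this shift.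
    have hx : x + δ ≤ x + δ * (C / h + 1) := by
      gcongr
      exact le_mul_of_one_le_right zero_le le_add_self
    have c1 := avg_le_of_le_shift (monotone_apply α.2 (Iic (x + δ))) (fun _ => NNReal.coe_nonneg _)
      (monotone_apply α'.2 (Iic x)) hh (fun s hs => up s (hs.trans le_self_add) x) (b1 _)
    have c2 := avg_le_of_le_shift (monotone_apply α'.2 (Iic (x + δ))) (fun _ => NNReal.coe_nonneg _)
      (monotone_apply α.2 (Iic x)) hh (fun s hs => low s (hs.trans le_self_add) x) (b2 _)
    rw [← avgM_Iic, ← avgM_Iic] at c1 c2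
    have m1 := monotone_Iic (avgM α h t) hx
    have m2 := monotone_Iic (avgM α' h t) hx
    simp only at m1 m2
    rw [← NNReal.coe_le_coe, ← NNReal.coe_le_coe]
    simp only [NNReal.coe_add, NNReal.coe_mul, NNReal.coe_div, NNReal.coe_one] at *
    constructor <;> linarith
  refine (dist_le_of_levyClose (half_pos hε') (hclose.mono hδ)).trans_lt ?_
  exact_mod_cast half_lt_self hε'

/-! ### Measurability -/

/-- An iterated limit of continuous maps: the values in the step paths are first replaced by
averages over shrinking windows, then the mesh tends to zero. -/
lemma measurable_jointData :
    @Measurable _ _ (borel (DMup × DRup)) (borel (D (M × ℝ))) jointData := by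
  let _ : MeasurableSpace (DMup × DRup) := borel _
  have : BorelSpace (DMup × DRup) := ⟨rfl⟩
  let _ : MeasurableSpace (D (M × ℝ)) := borel _
  have : BorelSpace (D (M × ℝ)) := ⟨rfl⟩
  refine measurable_of_tendsto_metrizable (f := fun (n : ℕ) (p : DMup × DRup) =>
    step n fun k => jointData p ((k : ℝ≥0) / ((n : ℝ≥0) + 1))) (fun n => ?_)
    (tendsto_pi_nhds.2 fun p => tendsto_step (jointData p))
  refine measurable_of_tendsto_metrizable (f := fun (j : ℕ) (p : DMup × DRup) =>
    step n fun k => (avgM p.1 (1 / ((j : ℝ≥0) + 1)) ((k : ℝ≥0) / ((n : ℝ≥0) + 1)),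
      avg p.2.1 (1 / ((j : ℝ≥0) + 1)) ((k : ℝ≥0) / ((n : ℝ≥0) + 1)))) (fun j => ?_)
    (tendsto_pi_nhds.2 fun p => ?_)
  · refine ((continuous_step n).comp (continuous_pi fun k => ?_)).measurable
    exact ((continuous_avgM (by positivity) _).comp continuous_fst).prodMk
      ((continuous_avg (by positivity) _).comp continuous_snd)
  · refine ((continuous_step n).tendsto _).comp (tendsto_pi_nhds.2 fun k => ?_)
    exact (tendsto_avgM p.1 _).prodMk_nhds (tendsto_avg p.2.2.2 (p.2.1.cadlag.1 _))

lemma tendsto_of_tendsto_jointSol {ι : Type*} {L : Filter ι} {u : ι → D M × DMup × DRup}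
    {s : D M × DMup × DRup} (h : Tendsto (fun i => jointSol (u i)) L (𝓝 (jointSol s))) :
    Tendsto u L (𝓝 s) := by
  have h' := tendsto_D_iff.1 h
  have h1 : Tendsto (fun i => (u i).1) L (𝓝 s.1) := tendsto_D_iff.2 fun T ε hε => by
    filter_upwards [h' T ε hε] with i ⟨τ, hτ⟩
    exact ⟨τ, fun t ht => ⟨(hτ t ht).1, (le_max_left _ _).trans_lt (hτ t ht).2⟩⟩
  have h2 : Tendsto (fun i => (u i).2.1) L (𝓝 s.2.1) :=
    tendsto_subtype_rng.2 <| tendsto_D_iff.2 fun T ε hε => by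
      filter_upwards [h' T ε hε] with i ⟨τ, hτ⟩
      exact ⟨τ, fun t ht => ⟨(hτ t ht).1,
        ((le_max_left _ _).trans (le_max_right _ _)).trans_lt (hτ t ht).2⟩⟩
  have h3 : Tendsto (fun i => (u i).2.2) L (𝓝 s.2.2) :=
    tendsto_subtype_rng.2 <| tendsto_D_iff.2 fun T ε hε => by
      filter_upwards [h' T ε hε] with i ⟨τ, hτ⟩
      exact ⟨τ, fun t ht => ⟨(hτ t ht).1,
        ((le_max_right _ _).trans (le_max_right _ _)).trans_lt (hτ t ht).2⟩⟩
  exact h1.prodMk_nhds (h2.prodMk_nhds h3)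

lemma measurable_skorokhodMap :
    @Measurable _ _ (borel (DMup × DRup)) (borel (D M × DMup × DRup)) skorokhodMap := by
  let _ : MeasurableSpace (DMup × DRup) := borel _
  let _ : MeasurableSpace (D M × DMup × DRup) := borel _
  have : BorelSpace (D M × DMup × DRup) := ⟨rfl⟩
  let _ : MeasurableSpace (D (M × ℝ)) := borel _
  have : BorelSpace (D (M × ℝ)) := ⟨rfl⟩
  refine measurable_of_isOpen fun U hU => ?_
  -- `tendsto_jointSol` gives each `p` with image in `U` a neighbourhood `W` of `jointData p` whose
  -- preimage maps into `U`. The union of all such `W` is open, and its preimage under `jointData`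
  -- is exactly that of `U` under the Skorokhod map.
  set V := ⋃₀ {W : Set (D (M × ℝ)) | IsOpen W ∧ jointData ⁻¹' W ⊆ skorokhodMap ⁻¹' U} with hV
  have hVU : skorokhodMap ⁻¹' U = jointData ⁻¹' V := by
    refine Subset.antisymm (fun p hp => ?_) fun p ⟨W, hW, hpW⟩ => hW.2 hpW
    have h : Tendsto skorokhodMap (comap jointData (𝓝 (jointData p))) (𝓝 (skorokhodMap p)) :=
      tendsto_of_tendsto_jointSol (tendsto_jointSol tendsto_comap)
    obtain ⟨W, hW, hWU⟩ := mem_comap.1 (h (hU.mem_nhds hp))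
    obtain ⟨W', hW', ho, hpW⟩ := mem_nhds_iff.1 hW
    exact ⟨W', ⟨ho, (preimage_mono hW').trans hWU⟩, hpW⟩
  rw [hVU]
  exact measurable_jointData (isOpen_sUnion fun W hW => hW.1).measurableSet

end MVSP

theorem mainTheorem5 :
    ∃ Θ : MVSP.DMup × MVSP.DRup → MVSP.D MVSP.M × MVSP.DMup × MVSP.DRup,
      -- `Θ` is the solution map: `Θ (α, μ)` is the unique solution for the data `(α, μ)`
      (∀ p s, MVSP.SolvesMVSP p.1 p.2 s.1 s.2.1 s.2.2 ↔ s = Θ p) ∧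
      -- continuity of `Θ` in the joint `J₁` topologies at data with atomless `α`
      (∀ (u : ℕ → MVSP.DMup × MVSP.DRup) (p : MVSP.DMup × MVSP.DRup),
        MVSP.AtomlessPath p.1.1 →
        Tendsto (fun k => MVSP.jointData (u k)) atTop (𝓝 (MVSP.jointData p)) →
        Tendsto (fun k => MVSP.jointSol (Θ (u k))) atTop (𝓝 (MVSP.jointSol (Θ p)))) ∧
      -- in particular, continuity at continuous data with atomless `α`: for the product of the
      -- `J₁` topologies on all data, and for uniform convergence on compacts on continuous data
      (∀ q : MVSP.CM0up × MVSP.CRup,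
        ContinuousAt (fun p => MVSP.jointSol (Θ p)) (MVSP.inclusion q)) ∧
      Continuous (fun q : MVSP.CM0up × MVSP.CRup => MVSP.jointSol (Θ (MVSP.inclusion q))) ∧
      -- Borel measurability
      @Measurable _ _ (borel (MVSP.DMup × MVSP.DRup))
        (borel (MVSP.D MVSP.M × MVSP.DMup × MVSP.DRup)) Θ :=
  ⟨MVSP.skorokhodMap, MVSP.solves_iff, fun _ _ _ h => MVSP.tendsto_jointSol h,
    MVSP.continuousAt_jointSol_inclusion, MVSP.continuous_jointSol_inclusion,
    MVSP.measurable_skorokhodMap⟩
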